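/- An algebraic set in $\mathbb C^d$ is the common zero set of finitely many polynomials, and a variety is a nonempty algebraic set that is not the union of two strictly smaller algebraic sets. The dimension of a variety $V$ is the largest $r$ for which there is a chain of varieties $V_0\subsetneq V_1\subsetneq\dots\subsetneq V_r=V$. The degree of an $r$-dimensional variety $V$ is the number $\delta$ such that almost every affine subspace of codimension $r$ meets $V$ in exactly $\delta$ points. A point $p$ of a $k$-dimensional variety $V$ is smooth if $V$ is, in a neighbourhood of $p$, a $k$-dimensional complex submanifold of $\mathbb C^d$, and singular otherwise; $V^{\mathrm{sing}}$ denotes the set of singular points of $V$. For all natural numbers $d$ and $D$ there is a constant $C=C(d,D)$ such that the following holds. Let $V\subset\mathbb C^d$ be a variety of dimension $k$ and degree at most $D$. Then there are at most $C$ varieties $W_1,\dots,W_m$, each contained in $V$, of dimension at most $k-1$ and of degree at most $C$, such that $$V^{\mathrm{sing}}\subseteq W_1\cup\dots\cup W_m .$$ (In particular, $V^{\mathrm{sing}}=\emptyset$ if $k=0$.) -/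

import Mathlib

open MeasureTheory

/-- Algebraic sets in `ℂ^d`: common zero sets of finitely many polynomials. -/
def IsAlgebraicSet {d : ℕ} (V : Set (Fin d → ℂ)) : Prop :=
  ∃ S : Finset (MvPolynomial (Fin d) ℂ), V = {x | ∀ P ∈ S, MvPolynomial.eval x P = 0}

/-- Algebraic varieties in `ℂ^d`: nonempty algebraic sets that are not the union of two strictly
smaller algebraic sets. -/
def IsVariety {d : ℕ} (V : Set (Fin d → ℂ)) : Prop :=
  IsAlgebraicSet V ∧ V.Nonempty ∧
    ¬ ∃ A B : Set (Fin d → ℂ),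
      IsAlgebraicSet A ∧ IsAlgebraicSet B ∧ A ⊂ V ∧ B ⊂ V ∧ V = A ∪ B

/-- `V` has dimension `r`: the number `r` is the largest natural number for which there is a
strictly increasing chain of varieties `V₀ ⊂ V₁ ⊂ ⋯ ⊂ V_r = V`. -/
def HasDim {d : ℕ} (V : Set (Fin d → ℂ)) (r : ℕ) : Prop :=
  IsGreatest {s : ℕ | ∃ c : Fin (s + 1) → Set (Fin d → ℂ),
    StrictMono c ∧ (∀ i, IsVariety (c i)) ∧ c (Fin.last s) = V} r

/-- The affine subspace of `ℂ^d` cut out by the `r` linear equations `A x = b`, where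
`L = (A, b)`. For almost every `L` the matrix `A` has full rank, so that for `r ≤ d` the
subspace has codimension `r`; every affine subspace of codimension `r` arises in this way. -/
def affineSlice {d r : ℕ} (L : (Fin r → Fin d → ℂ) × (Fin r → ℂ)) : Set (Fin d → ℂ) :=
  {x | ∀ i, ∑ j, L.1 i j * x j = L.2 i}

/-- `V` has degree `δ`: with `r = dim V`, almost every affine subspace of codimension `r` meets
`V` in exactly `δ` points. -/
def HasDegree {d : ℕ} (V : Set (Fin d → ℂ)) (δ : ℕ) : Prop :=
  ∃ r : ℕ, HasDim V r ∧
    ∀ᵐ L : (Fin r → Fin d → ℂ) × (Fin r → ℂ) ∂volume, (V ∩ affineSlice L).encard = δ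

/-- `p` is a smooth point of the `k`-dimensional variety `V`: near `p`, the set `V` is a
`k`-dimensional complex submanifold of `ℂ^d`, that is, there is a biholomorphic chart of `ℂ^d`
around `p` in which `V` is the set where all coordinates after the first `k` vanish. -/
def IsSmoothPoint {d : ℕ} (V : Set (Fin d → ℂ)) (k : ℕ) (p : Fin d → ℂ) : Prop :=
  p ∈ V ∧ ∃ e : OpenPartialHomeomorph (Fin d → ℂ) (Fin d → ℂ),
    p ∈ e.source ∧ DifferentiableOn ℂ e e.source ∧ DifferentiableOn ℂ e.symm e.target ∧
      ∀ x ∈ e.source, x ∈ V ↔ ∀ i : Fin d, k ≤ (i : ℕ) → e x i = 0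

/-- The set of singular points of the `k`-dimensional variety `V`. -/
def singularLocus {d : ℕ} (V : Set (Fin d → ℂ)) (k : ℕ) : Set (Fin d → ℂ) :=
  {p | p ∈ V ∧ ¬ IsSmoothPoint V k p}

/-! Write V as the zero locus of a prime P, of dimension k and degree n. Let A be a generic matrix
with k+1 rows and x a generic point of V. The relations between the entries of A and the coordinates
y of Ax form a principal prime ideal, generated by an affine Chow form F(A, y) (`exists_chowForm`).
Its degree in each y_i is at most n, because k rows already cut V in n points: n is the degree of
the corresponding extension of fraction fields (`exists_slice_data`).

Differentiating F(A, Ax) = 0 in the entries of one distinguished row, with y₀ the corresponding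
coordinate of Ax, gives ∂F/∂A₀ⱼ + xⱼ ∂F/∂y₀ = 0 on V. So wherever ∂F/∂y₀ is nonzero, the point x is
a rational function of (A, Ax), and solving F = 0 for y₀ by the implicit function theorem exhibits V
locally as the image of a holomorphic section of a linear map (`isSmoothPoint_of_chowForm`). Fix a
numerical A for which h(x) = ∂F/∂y₀(A, Ax) does not vanish identically on V. Then deg h ≤ (k+1)n,
and every singular point lies in V ∩ {h = 0}.

The W's are the components of V ∩ {h = 0}. Each has dimension k-1
(`trdeg_quotient_minimalPrimes_sup`). A crude Bézout bound (`sum_degree_le_of_hypersurface_section`)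
controls the sum of their degrees, hence also their number. For it, homogenize h and substitute
∂F/∂y₀ and -∂F/∂A₀ⱼ to obtain H(A, y), which F does not divide but which vanishes at (A, Ax)
whenever x lies in V ∩ {h = 0}. The resultant of F and H in y₀ is nonzero of bounded degree. Fixing
a generic slice of all components by k-1 rows and using the remaining row to separate the points
found, these points become distinct roots of the resultant. -/

/-! ### Transcendence degree and primes of codimension one -/

-- If equality held, lifts to R of a transcendence basis of R/Q would be a transcendence basis of R.
-- A nonzero element of Q would then be algebraic over them, so Q would contain a nonzero polynomial
-- in the lifts, contradicting their independence modulo Q.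
open Algebra in
theorem trdeg_quotient_lt {k R : Type} [Field k] [CommRing R] [IsDomain R] [Algebra k R]
    [Algebra.FiniteType k R] (Q : Ideal R) [Q.IsPrime] (hQ : Q ≠ ⊥) :
    trdeg k (R ⧸ Q) < trdeg k R := by
  refine lt_of_le_of_ne (trdeg_le_of_surjective (Ideal.Quotient.mkₐ k Q)
    (Ideal.Quotient.mkₐ_surjective k Q)) fun heq => ?_
  have : FaithfulSMul k (R ⧸ Q) := (faithfulSMul_iff_algebraMap_injective k (R ⧸ Q)).mpr
    (algebraMap k (R ⧸ Q)).injective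
  obtain ⟨s, hs⟩ := exists_isTranscendenceBasis k (R ⧸ Q)
  have hsurj := Ideal.Quotient.mkₐ_surjective k Q
  choose g hg using hsurj
  let x : s → R := fun a => g a
  have hx : ⇑(Ideal.Quotient.mkₐ k Q) ∘ x = ((↑) : s → R ⧸ Q) := funext fun a => hg a
  have hxi : AlgebraicIndependent k x :=
    AlgebraicIndependent.of_comp (Ideal.Quotient.mkₐ k Q) (by rw [hx]; exact hs.1)
  have hb : IsTranscendenceBasis k x :=
    hxi.isTranscendenceBasis_of_trdeg_le (trdeg_lt_aleph0_of_finiteType)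
      (by rw [hs.cardinalMk_eq_trdeg, heq])
  obtain ⟨h, hhQ, hh0⟩ := Submodule.exists_mem_ne_zero_of_ne_bot hQ
  have := hb.isAlgebraic
  have hne := Ideal.comap_ne_bot_of_algebraic_mem (R := adjoin k (Set.range x)) hh0 hhQ
    (Algebra.IsAlgebraic.isAlgebraic h)
  obtain ⟨b, hbQ, hb0⟩ := Submodule.exists_mem_ne_zero_of_ne_bot hne
  obtain ⟨b, hbm⟩ := b
  rw [adjoin_range_eq_range_aeval] at hbm
  obtain ⟨p, rfl⟩ := hbm
  apply hb0
  have h1 : MvPolynomial.aeval ((↑) : s → R ⧸ Q) p = 0 := by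
    rw [← hx]
    exact (MvPolynomial.comp_aeval_apply x (Ideal.Quotient.mkₐ k Q) p).symm.trans
      (Ideal.Quotient.eq_zero_iff_mem.mpr hbQ)
  have hp0 : p = 0 := (injective_iff_map_eq_zero _).mp hs.1 p h1
  subst hp0
  ext
  simp

/-- The quotient of a polynomial ring by a nonconstant polynomial still contains
all but one of the variables as an algebraically independent family. -/
theorem exists_algebraicIndependent_quotient_span {k : Type} [Field k] {s : ℕ}
    (f : MvPolynomial (Fin s) k) (hf : f ≠ 0) (hu : ¬ IsUnit f) :
    ∃ i : Fin s, AlgebraicIndependent k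
      (fun j : {j : Fin s // j ≠ i} => Ideal.Quotient.mk (Ideal.span {f}) (MvPolynomial.X j.1)) := by
  obtain ⟨i, hi⟩ : ∃ i, MvPolynomial.degreeOf i f ≠ 0 := by
    by_contra! hcon
    apply hu
    have h0 : f.totalDegree = 0 := by
      rw [MvPolynomial.totalDegree_eq_zero_iff]
      intro m hm n
      have := MvPolynomial.monomial_le_degreeOf n hm
      have h2 := hcon n
      omega
    rw [MvPolynomial.totalDegree_eq_zero_iff_eq_C] at h0
    rw [h0]
    apply IsUnit.map
    rw [isUnit_iff_ne_zero]
    rintro h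
    rw [h] at h0
    exact hf (by simpa using h0)
  refine ⟨i, (injective_iff_map_eq_zero _).mpr fun p hp => ?_⟩
  have h1 : Ideal.Quotient.mk (Ideal.span {f}) (MvPolynomial.rename Subtype.val p) = 0 := by
    rw [← hp, MvPolynomial.rename_eq_aeval]
    exact MvPolynomial.comp_aeval_apply _ (Ideal.Quotient.mkₐ k (Ideal.span {f})) p
  -- A relation among the other variables is a multiple of f in which the variable i does not occur,
  -- although f has positive degree in it.
  rw [Ideal.Quotient.eq_zero_iff_mem, Ideal.mem_span_singleton] at h1
  obtain ⟨q, hq⟩ := h1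
  by_contra hp0
  have hr0 : MvPolynomial.rename Subtype.val p ≠ 0 := by
    rwa [Ne, map_eq_zero_iff _ (MvPolynomial.rename_injective _ Subtype.val_injective)]
  have hq0 : q ≠ 0 := by rintro rfl; simp at hq; exact hr0 (by simp [hq])
  have h2 := congrArg (MvPolynomial.degreeOf i) hq
  rw [MvPolynomial.degreeOf_mul_eq hf hq0] at h2
  have h3 : MvPolynomial.degreeOf i (MvPolynomial.rename Subtype.val p) = 0 := by
    by_contra hne
    rw [← Ne, ← MvPolynomial.mem_vars_iff_degreeOf_ne_zero] at hne
    obtain ⟨j, -, hj⟩ := MvPolynomial.mem_vars_rename _ _ hne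
    exact j.2 hj
  omega

open Algebra in
/-- A prime minimal over a nonzero principal ideal of an affine domain has codimension one. -/
theorem trdeg_quotient_minimalPrimes {k R : Type} [Field k] [CommRing R] [IsDomain R] [Algebra k R]
    [Algebra.FiniteType k R] {h : R} (hh : h ≠ 0) (Q : Ideal R)
    (hQ : Q ∈ (Ideal.span {h}).minimalPrimes) :
    trdeg k (R ⧸ Q) + 1 = trdeg k R := by
  have hQp : Q.IsPrime := hQ.isPrime
  have hhQ : h ∈ Q := hQ.1.2 (Ideal.mem_span_singleton_self h)
  have hQ0 : Q ≠ ⊥ := fun h0 => hh (by simpa [h0] using hhQ)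
  have hlt := trdeg_quotient_lt (k := k) Q hQ0
  have hfin : trdeg k R < Cardinal.aleph0 := trdeg_lt_aleph0_of_finiteType
  -- Noether normalization moves the question to a polynomial ring, which is factorial: the
  -- contraction q of Q turns out to be generated by one polynomial.
  obtain ⟨s, g, hginj, hgint⟩ := exists_integral_inj_algHom_of_fg k R
  let := g.toRingHom.toAlgebra
  have hnoeth : IsNoetherianRing R := Algebra.FiniteType.isNoetherianRing k R
  have htower : IsScalarTower k (MvPolynomial (Fin s) k) R :=
    IsScalarTower.of_algebraMap_eq' g.comp_algebraMap.symm
  have hintegral : Algebra.IsIntegral (MvPolynomial (Fin s) k) R := ⟨hgint⟩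
  have hfaith : FaithfulSMul (MvPolynomial (Fin s) k) R :=
    (faithfulSMul_iff_algebraMap_injective _ _).mpr hginj
  have htr : trdeg k R = s := by
    rw [← trdeg_add_eq k (MvPolynomial (Fin s) k) (A := R), trdeg_eq_zero (R := MvPolynomial (Fin s) k)]
    simp
  let q := Q.comap (algebraMap (MvPolynomial (Fin s) k) R)
  have hlies : Q.LiesOver q := ⟨rfl⟩
  have hqp : q.IsPrime := Ideal.comap_isPrime _ _
  have hq0 : q ≠ ⊥ := Ideal.comap_ne_bot_of_integral_mem hh hhQ (Algebra.IsIntegral.isIntegral h)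
  -- Krull's principal ideal theorem bounds the height of Q, and going down transfers the bound to
  -- q.
  have hqh : q.height ≤ 1 := by
    have h1 := Ideal.height_eq_height_add_of_liesOver_of_hasGoingDown q Q
    have h2 := Ideal.height_le_one_of_isPrincipal_of_mem_minimalPrimes _ Q hQ
    rw [h1] at h2
    exact le_trans le_self_add h2
  obtain ⟨f, hfq, hfp⟩ := hqp.exists_mem_prime_of_ne_bot hq0
  have hspan : (Ideal.span {f}).IsPrime := (Ideal.span_singleton_prime hfp.ne_zero).mpr hfp
  have hfq' : Ideal.span {f} = q := by
    have hle : Ideal.span {f} ≤ q := (Ideal.span_singleton_le_iff_mem _).mpr hfq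
    refine Ideal.eq_of_le_of_height_le _ hle (hqh.trans ?_)
    exact Ideal.one_le_height_span_singleton_of_mem_nonZeroDivisors
      (mem_nonZeroDivisors_of_ne_zero hfp.ne_zero)
  obtain ⟨i, hi⟩ := exists_algebraicIndependent_quotient_span f hfp.ne_zero hfp.not_isUnit
  have hfq'' : Ideal.span {f} = Q.comap g := hfq'
  let φ : (MvPolynomial (Fin s) k ⧸ Ideal.span {f}) →ₐ[k] R ⧸ Q :=
    Ideal.quotientMapₐ Q g hfq''.le
  have hφ : Function.Injective φ := Ideal.quotientMap_injective' (H := hfq''.le) hfq''.ge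
  have hc := (hi.map' hφ).cardinalMk_le_trdeg
  rw [Cardinal.mk_fintype, Fintype.card_subtype_compl, Fintype.card_fin,
    Fintype.card_subtype_eq] at hc
  obtain ⟨m, hm⟩ := Cardinal.lt_aleph0.mp (hlt.trans hfin)
  rw [hm] at hc hlt
  rw [htr] at hlt
  rw [hm, htr]
  norm_cast at hc hlt ⊢
  omega

/-! ### Points of a generic fibre and the degree of the function field extension -/

section GenericFiber

set_option linter.unusedSectionVars false

open Polynomial

variable {B S K L : Type} [CommRing B] [IsDomain B] [CommRing S] [IsDomain S] [Algebra B S]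
  [Field K] [Algebra B K] [IsFractionRing B K] [Field L] [Algebra S L] [IsFractionRing S L]
  [Algebra B L] [IsScalarTower B S L] [Algebra K L] [IsScalarTower B K L]

theorem exists_mul_eq_algebraMap_of_isAlgebraic [FaithfulSMul B S] [Algebra.IsAlgebraic B S] (t : S)
    (ht : t ≠ 0) : ∃ b : B, b ≠ 0 ∧ ∃ t' : S, t * t' = algebraMap B S b := by
  have hne := Ideal.comap_ne_bot_of_algebraic_mem (R := B) ht (Ideal.mem_span_singleton_self t)
    (Algebra.IsAlgebraic.isAlgebraic t)
  obtain ⟨b, hb, hb0⟩ := Submodule.exists_mem_ne_zero_of_ne_bot hne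
  obtain ⟨t', ht'⟩ := Ideal.mem_span_singleton'.mp hb
  exact ⟨b, hb0, t', by rw [mul_comm, ht']⟩

variable (B S K L) in
theorem finite_fractionField_of_isAlgebraic [FaithfulSMul B S] [Algebra.IsAlgebraic B S]
    [Algebra.FiniteType B S] : Module.Finite K L := by
  have h1 : Algebra.EssFiniteType S L := .of_isLocalization _ (nonZeroDivisors S)
  have h2 : Algebra.EssFiniteType B L := .comp B S L
  have h3 : Algebra.EssFiniteType K L := .of_comp B K L
  have h4 : Algebra.IsAlgebraic K L := by
    rw [← IsFractionRing.comap_isAlgebraic_iff (A := B) (K := K) (C := L)]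
    have h5 : FaithfulSMul B L := FaithfulSMul.trans B S L
    exact (IsFractionRing.isAlgebraic_iff' B S L).mp inferInstance
  exact Algebra.finite_of_essFiniteType_of_isAlgebraic

-- A primitive element is a fraction s/t. A multiple of t lies in the base, so multiplying by a
-- nonzero element of K moves the primitive element into S.
variable (K L) in
theorem exists_primitive_element_mem [FaithfulSMul B S] [Algebra.IsAlgebraic B S]
    [Module.Finite K L] [CharZero K] :
    ∃ θ : S, Algebra.adjoin K {algebraMap S L θ} = ⊤ := by
  obtain ⟨α, hα⟩ := Field.exists_primitive_element K L
  obtain ⟨s, t, ht, rfl⟩ := IsFractionRing.div_surjective (A := S) α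
  obtain ⟨b, hb, t', htt⟩ := exists_mul_eq_algebraMap_of_isAlgebraic (B := B) t
    (nonZeroDivisors.ne_zero ht)
  refine ⟨s * t', ?_⟩
  have hbK : algebraMap B K b ≠ 0 := by
    rwa [Ne, FaithfulSMul.algebraMap_eq_zero_iff]
  have hbL : algebraMap K L (algebraMap B K b) ≠ 0 := by
    rwa [Ne, FaithfulSMul.algebraMap_eq_zero_iff]
  have htL : algebraMap S L t ≠ 0 := by
    rw [Ne, FaithfulSMul.algebraMap_eq_zero_iff]
    exact nonZeroDivisors.ne_zero ht
  have heq : algebraMap S L s / algebraMap S L t =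
      algebraMap K L (algebraMap B K b)⁻¹ * algebraMap S L (s * t') := by
    have : algebraMap K L (algebraMap B K b) = algebraMap S L t * algebraMap S L t' := by
      rw [← IsScalarTower.algebraMap_apply B K L, IsScalarTower.algebraMap_apply B S L, ← htt,
        map_mul]
    rw [map_inv₀, map_mul]
    field_simp
    rw [this]; ring
  rw [← IntermediateField.adjoin_simple_toSubalgebra_of_isAlgebraic
    (Algebra.IsAlgebraic.isAlgebraic _), ← IntermediateField.top_toSubalgebra]
  congr 1
  rw [eq_top_iff, ← hα, IntermediateField.adjoin_simple_le_iff, heq]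
  exact mul_mem (IntermediateField.algebraMap_mem _ _) (IntermediateField.mem_adjoin_simple_self _ _)

theorem exists_map_eq_C_mul {g : B} {q : K[X]}
    (h : ∀ a ∈ q.coeffs, IsLocalization.IsInteger B (g • a)) :
    ∃ G : B[X], G.map (algebraMap B K) = C (algebraMap B K g) * q := by
  rw [← Polynomial.mem_lifts, Polynomial.lifts_iff_coeff_lifts]
  intro n
  rw [coeff_C_mul, ← Algebra.smul_def]
  by_cases h0 : q.coeff n = 0
  · rw [h0, smul_zero]; exact ⟨0, map_zero _⟩
  · exact h _ (coeff_mem_coeffs h0)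

variable (B S K L) in
/-- Over a generic point of the base, the number of points in the fibre of a generically finite
extension of domains of characteristic zero is the degree of the extension of fraction fields. -/
theorem exists_card_fiber_eq_finrank [IsIntegrallyClosed B] [FaithfulSMul B S]
    [Algebra.IsAlgebraic B S] [Algebra.FiniteType B S] [CharZero K] :
    ∃ g : B, g ≠ 0 ∧ ∀ σ : B →+* ℂ, σ g ≠ 0 →
      Nat.card {τ : S →+* ℂ // τ.comp (algebraMap B S) = σ} = Module.finrank K L := by
  classical
  have hfin : Module.Finite K L := finite_fractionField_of_isAlgebraic B S K L
  obtain ⟨θ, hθ⟩ := exists_primitive_element_mem (B := B) (S := S) K L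
  set θL := algebraMap S L θ with hθL
  have hθint : IsIntegral K θL := Algebra.IsIntegral.isIntegral θL
  obtain ⟨gens, hgens⟩ := (inferInstance : Algebra.FiniteType B S).out
  have hq : ∀ x : S, ∃ q : K[X], aeval θL q = algebraMap S L x := by
    intro x
    have : algebraMap S L x ∈ Algebra.adjoin K {θL} := by rw [hθ]; trivial
    rwa [Algebra.adjoin_singleton_eq_range_aeval] at this
  choose q hq using hq
  have hsep : (minpoly K θL).Separable := (minpoly.irreducible hθint).separable
  obtain ⟨u, v, huv⟩ := hsep
  -- The common denominator g of these coefficients is the exceptional locus. Away from it the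
  -- generators of S are polynomials in θ, θ is integral, and the Bézout identity witnessing
  -- separability of its minimal polynomial survives specialization.
  let coefs : Finset K := gens.biUnion (fun x => (q x).coeffs) ∪ (minpoly K θL).coeffs ∪
    u.coeffs ∪ v.coeffs
  obtain ⟨⟨g, hgmem⟩, hg⟩ := IsLocalization.exist_integer_multiples_of_finset
    (nonZeroDivisors B) coefs
  have hg0 : g ≠ 0 := nonZeroDivisors.ne_zero hgmem
  refine ⟨g, hg0, fun σ hσ => ?_⟩
  have hM : Submonoid.powers g ≤ nonZeroDivisors B := powers_le_nonZeroDivisors_of_noZeroDivisors hg0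
  let Bg := Localization.subalgebra.ofField K (Submonoid.powers g) hM
  have hloc : IsLocalization.Away g Bg := Localization.subalgebra.isLocalization_ofField K _ hM
  have hic : IsIntegrallyClosed Bg :=
    isIntegrallyClosed_of_isLocalization Bg (Submonoid.powers g) hM
  have hgK : algebraMap B K g ≠ 0 := by rwa [Ne, FaithfulSMul.algebraMap_eq_zero_iff]
  have hlift : ∀ p : K[X], p.coeffs ⊆ coefs → p ∈ Polynomial.lifts (algebraMap Bg K) := by
    intro p hp
    rw [Polynomial.lifts_iff_coeff_lifts]
    intro n
    by_cases h0 : p.coeff n = 0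
    · rw [h0]; exact ⟨0, map_zero _⟩
    · obtain ⟨c, hc⟩ := hg _ (hp (coeff_mem_coeffs h0))
      refine ⟨⟨p.coeff n, c, g, Submonoid.mem_powers g, ?_⟩, rfl⟩
      rw [hc, Algebra.smul_def]
      field_simp
  have hmin : (minpoly K θL).coeffs ⊆ coefs := fun a ha => by simp [coefs, ha]
  have hintegral : IsIntegral Bg θL := by
    obtain ⟨p, hp, -, hmonic⟩ := Polynomial.lifts_and_natDegree_eq_and_monic (hlift _ hmin)
      (minpoly.monic hθint)
    refine ⟨p, hmonic, ?_⟩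
    rw [← aeval_def, ← aeval_map_algebraMap K, hp, minpoly.aeval]
  have hP : minpoly K θL = (minpoly Bg θL).map (algebraMap Bg K) :=
    minpoly.isIntegrallyClosed_eq_field_fractions' K hintegral
  let σ' : Bg →+* ℂ := IsLocalization.Away.lift g (isUnit_iff_ne_zero.mpr hσ)
  have hσ' : ∀ b, σ' (algebraMap B Bg b) = σ b := fun b => IsLocalization.Away.lift_eq g _ b
  let := σ'.toAlgebra
  let := σ.toAlgebra
  have htow : IsScalarTower B Bg ℂ := .of_algebraMap_eq fun b => (hσ' b).symm
  let P := minpoly Bg θL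
  have hinj : Function.Injective (algebraMap Bg K) := Subtype.val_injective
  have hroots : Nat.card {y : ℂ // aeval y P = 0} = Module.finrank K L := by
    have hPsep : P.Separable := by
      obtain ⟨u', hu'⟩ := hlift u fun a ha => by simp [coefs, ha]
      obtain ⟨v', hv'⟩ := hlift v fun a ha => by simp [coefs, ha]
      refine ⟨u', v', Polynomial.map_injective _ hinj ?_⟩
      rw [Polynomial.map_add, Polynomial.map_mul, Polynomial.map_mul, ← derivative_map, ← hP,
        Polynomial.map_one, ← huv]
      congr 2
    have hmon : P.Monic := minpoly.monic hintegral
    have hdeg : (P.map (algebraMap Bg ℂ)).natDegree = Module.finrank K L := by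
      rw [hmon.natDegree_map]
      have h1 : (minpoly K θL).natDegree = P.natDegree := by rw [hP, hmon.natDegree_map]
      rw [← h1, ← IntermediateField.adjoin.finrank hθint]
      have : IntermediateField.adjoin K {θL} = ⊤ := by
        rw [← IntermediateField.toSubalgebra_injective.eq_iff,
          IntermediateField.adjoin_simple_toSubalgebra_of_isAlgebraic
          (Algebra.IsAlgebraic.isAlgebraic _), hθ, IntermediateField.top_toSubalgebra]
      rw [this, IntermediateField.finrank_top']
    have hcard : Fintype.card ((P.map (algebraMap Bg ℂ)).rootSet ℂ) =
        (P.map (algebraMap Bg ℂ)).natDegree :=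
      card_rootSet_eq_natDegree hPsep.map (IsAlgClosed.splits _)
    rw [← hdeg, ← hcard, ← Nat.card_eq_fintype_card]
    refine Nat.card_congr (Equiv.subtypeEquivRight fun y => ?_)
    rw [mem_rootSet_of_ne (hmon.map _).ne_zero, aeval_map_algebraMap]
  rw [← hroots]
  obtain ⟨F, hF⟩ := exists_map_eq_C_mul (g := g) (q := minpoly K θL) fun a ha => hg a (hmin ha)
  have hFP : F.map (algebraMap B Bg) = C (algebraMap B Bg g) * P := by
    refine Polynomial.map_injective _ hinj ?_
    rw [Polynomial.map_map, Polynomial.map_mul, Polynomial.map_C, ← hP,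
      ← IsScalarTower.algebraMap_eq, ← IsScalarTower.algebraMap_apply, hF]
  have hFθ : aeval θ F = 0 := by
    apply FaithfulSMul.algebraMap_injective S L
    rw [map_zero, ← aeval_algebraMap_apply, ← aeval_map_algebraMap K, hF, map_mul, minpoly.aeval,
      mul_zero]
  have hroot : ∀ τ : S →ₐ[B] ℂ, aeval (τ θ) P = 0 := by
    intro τ
    have h1 : aeval (τ θ) F = 0 := by rw [aeval_algHom_apply, hFθ, map_zero]
    rw [← aeval_map_algebraMap Bg, hFP, map_mul, aeval_C,
      ← IsScalarTower.algebraMap_apply] at h1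
    exact (mul_eq_zero.mp h1).resolve_left hσ
  have hG : ∀ x ∈ gens, ∃ G : B[X], aeval θ G = algebraMap B S g * x := by
    intro x hx
    obtain ⟨G, hG⟩ := exists_map_eq_C_mul (g := g) (q := q x) fun a ha => hg a (by
      simp only [coefs, Finset.mem_union, Finset.mem_biUnion]
      exact Or.inl (Or.inl (Or.inl ⟨x, hx, ha⟩)))
    refine ⟨G, FaithfulSMul.algebraMap_injective S L ?_⟩
    rw [← aeval_algebraMap_apply, ← aeval_map_algebraMap K, hG, map_mul, hq, aeval_C, map_mul,
      ← IsScalarTower.algebraMap_apply, ← IsScalarTower.algebraMap_apply]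
  let toAlg : {τ : S →+* ℂ // τ.comp (algebraMap B S) = σ} → (S →ₐ[B] ℂ) := fun τ =>
    { τ.1 with commutes' := fun b => congrArg (fun f => f b) τ.2 }
  -- A homomorphism over σ is determined by the image of θ, since g times each generator is a
  -- polynomial in θ. Conversely every root y of P occurs, since S embeds in the ring generated by θ
  -- over `Bg`, which is free with power basis θ and relation P.
  refine Nat.card_congr (Equiv.ofBijective
    (fun τ => (⟨τ.1 θ, hroot (toAlg τ)⟩ : {y : ℂ // aeval y P = 0})) ⟨?_, ?_⟩)
  · intro τ₁ τ₂ h12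
    have h12' : τ₁.1 θ = τ₂.1 θ := congrArg Subtype.val h12
    have : toAlg τ₁ = toAlg τ₂ := by
      refine AlgHom.ext_of_adjoin_eq_top hgens fun x hx => ?_
      obtain ⟨G, hG⟩ := hG x hx
      have h1 : ∀ τ : S →ₐ[B] ℂ, σ g * τ x = aeval (τ θ) G := by
        intro τ
        rw [aeval_algHom_apply, hG, map_mul, AlgHom.commutes]
        rfl
      have h2 := h1 (toAlg τ₁)
      have h3 : aeval (toAlg τ₁ θ) G = aeval (toAlg τ₂ θ) G := congrArg (fun y => aeval y G) h12'
      rw [h3, ← h1 (toAlg τ₂)] at h2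
      exact mul_left_cancel₀ hσ h2
    apply Subtype.ext
    ext x
    exact congrArg (fun f : S →ₐ[B] ℂ => f x) this
  · rintro ⟨y, hy⟩
    let Cg := Algebra.adjoin Bg {θL}
    have hmem : ∀ x : S, algebraMap S L x ∈ Cg := by
      intro x
      have hx : x ∈ Algebra.adjoin B (gens : Set S) := by rw [hgens]; trivial
      have hle : Algebra.adjoin B (gens : Set S) ≤
          (Cg.restrictScalars B).comap (IsScalarTower.toAlgHom B S L) := by
        rw [Algebra.adjoin_le_iff]
        intro x hx
        obtain ⟨q', hq'⟩ := hlift (q x) fun a ha => by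
          simp only [coefs, Finset.mem_union, Finset.mem_biUnion]
          exact Or.inl (Or.inl (Or.inl ⟨x, hx, ha⟩))
        have h1 := hq x
        rw [← hq'] at h1
        change algebraMap S L x ∈ Cg
        rw [← h1, coe_mapRingHom, aeval_map_algebraMap]
        exact Polynomial.aeval_mem_adjoin_singleton _ _
      exact hle hx
    let pb := Algebra.adjoin.powerBasis' hintegral
    have hgen : minpoly Bg pb.gen = P := (Algebra.adjoin.powerBasis'_minpoly_gen hintegral).symm
    let ψ : Cg →ₐ[Bg] ℂ := pb.lift y (by rw [hgen]; exact hy)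
    let ι : S →+* Cg := (algebraMap S L).codRestrict Cg hmem
    refine ⟨⟨(ψ : Cg →+* ℂ).comp ι, ?_⟩, Subtype.ext ?_⟩
    · ext b
      have h1 : ι (algebraMap B S b) = algebraMap Bg Cg (algebraMap B Bg b) := by
        apply Subtype.ext
        change algebraMap S L (algebraMap B S b) = algebraMap Bg L (algebraMap B Bg b)
        rw [← IsScalarTower.algebraMap_apply, ← IsScalarTower.algebraMap_apply]
      change ψ (ι (algebraMap B S b)) = σ b
      rw [h1, AlgHom.commutes]
      exact hσ' b
    · change ψ (ι θ) = y
      have h1 : ι θ = pb.gen := by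
        rw [Algebra.adjoin.powerBasis'_gen]
        rfl
      rw [h1]
      exact pb.lift_gen y _

end GenericFiber

/-! ### The ideal of relations of an algebraic element -/

section Relation

open Polynomial

variable {B S K L : Type} [CommRing B] [IsDomain B] [CommRing S] [IsDomain S] [Algebra B S]
  [Field K] [Algebra B K] [IsFractionRing B K] [Field L] [Algebra S L] [IsFractionRing S L]
  [Algebra B L] [IsScalarTower B S L] [Algebra K L] [IsScalarTower B K L]

variable (K L) in
/-- The polynomial relations satisfied by an algebraic element over a factorial domain form a
principal ideal generated by a prime of degree at most that of the field extension. -/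
theorem exists_prime_generator_relations [UniqueFactorizationMonoid B] [Module.Finite K L]
    (θ : S) : ∃ F : B[X], Prime F ∧ 0 < F.natDegree ∧ F.natDegree ≤ Module.finrank K L ∧
      aeval θ F = 0 ∧ ∀ G : B[X], aeval θ G = 0 → F ∣ G := by
  set θL := algebraMap S L θ with hθL
  have hintegral : IsIntegral K θL := Algebra.IsIntegral.isIntegral θL
  have hmap : ∀ G : B[X], aeval θ G = 0 ↔ aeval θL (G.map (algebraMap B K)) = 0 := by
    intro G
    rw [aeval_map_algebraMap, hθL, aeval_algebraMap_apply, FaithfulSMul.algebraMap_eq_zero_iff]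
  have hclear : ∀ q : K[X], ∃ b : B, b ≠ 0 ∧ ∃ G : B[X],
      G.map (algebraMap B K) = C (algebraMap B K b) * q := by
    intro q
    obtain ⟨⟨b, hb⟩, hbq⟩ := IsLocalization.exist_integer_multiples_of_finset
      (nonZeroDivisors B) q.coeffs
    exact ⟨b, nonZeroDivisors.ne_zero hb, exists_map_eq_C_mul hbq⟩
  have hinj : Function.Injective (algebraMap B K) := IsFractionRing.injective B K
  obtain ⟨b, hb, M, hM⟩ := hclear (minpoly K θL)
  have hbK : algebraMap B K b ≠ 0 := by rwa [Ne, FaithfulSMul.algebraMap_eq_zero_iff]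
  have hMθ : aeval θ M = 0 := by rw [hmap, hM, map_mul, minpoly.aeval, mul_zero]
  have hM0 : M ≠ 0 := by
    rintro rfl
    rw [Polynomial.map_zero, eq_comm, mul_eq_zero, C_eq_zero] at hM
    exact hM.elim hbK (minpoly.ne_zero hintegral)
  have hMdeg : M.natDegree = (minpoly K θL).natDegree := by
    rw [← natDegree_map_eq_of_injective hinj, hM, natDegree_C_mul hbK]
  -- M is the minimal polynomial with denominators cleared. S is a domain, so some prime factor of M
  -- already kills θ, and it has the same degree as M.
  obtain ⟨F, hFp, hFM, hFθ⟩ : ∃ F : B[X], Prime F ∧ F ∣ M ∧ aeval θ F = 0 := by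
    obtain ⟨f, hf, hfM⟩ := UniqueFactorizationMonoid.exists_prime_factors M hM0
    have h0 : aeval θ f.prod = 0 := by
      obtain ⟨c, hc⟩ := hfM.dvd'
      rw [hc, map_mul, hMθ, zero_mul]
    rw [map_multiset_prod, Multiset.prod_eq_zero_iff, Multiset.mem_map] at h0
    obtain ⟨F, hFf, hF⟩ := h0
    exact ⟨F, hf F hFf, (Multiset.dvd_prod hFf).trans hfM.dvd, hF⟩
  have hdvd : minpoly K θL ∣ F.map (algebraMap B K) := minpoly.dvd _ _ ((hmap F).mp hFθ)
  have hF0 : F.map (algebraMap B K) ≠ 0 := (Polynomial.map_ne_zero_iff hinj).mpr hFp.ne_zero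
  have hFdeg : F.natDegree = (minpoly K θL).natDegree := by
    refine le_antisymm (hMdeg ▸ natDegree_le_of_dvd hFM hM0) ?_
    rw [← natDegree_map_eq_of_injective hinj F]
    exact natDegree_le_of_dvd hdvd hF0
  have hFpos : 0 < F.natDegree := hFdeg ▸ minpoly.natDegree_pos hintegral
  have hassoc : F.map (algebraMap B K) ∣ minpoly K θL := by
    refine (associated_of_dvd_of_natDegree_le hdvd hF0 ?_).dvd'
    rw [natDegree_map_eq_of_injective hinj, hFdeg]
  refine ⟨F, hFp, hFpos, hFdeg ▸ minpoly.natDegree_le θL, hFθ, fun G hG => ?_⟩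
  obtain ⟨H, hH⟩ := hassoc.trans (minpoly.dvd _ _ ((hmap G).mp hG))
  obtain ⟨c, hc, H', hH'⟩ := hclear H
  have heq : C c * G = F * H' := by
    refine Polynomial.map_injective _ hinj ?_
    rw [Polynomial.map_mul, Polynomial.map_mul, Polynomial.map_C, hH, hH']
    ring
  -- As in Gauss's lemma, the prime F has positive degree and cannot divide the constant c
  -- introduced by clearing denominators.
  refine (hFp.dvd_or_dvd (heq ▸ dvd_mul_right F H')).resolve_left fun h => ?_
  have := natDegree_le_of_dvd h (C_ne_zero.mpr hc)
  rw [natDegree_C] at this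
  omega

end Relation

/-! ### Varieties, prime ideals and dimension -/

open Algebra in
theorem trdeg_quotient_lt_of_lt {k R : Type} [Field k] [CommRing R] [Algebra k R]
    [Algebra.FiniteType k R] {P Q : Ideal R} [P.IsPrime] [Q.IsPrime] (h : P < Q) :
    trdeg k (R ⧸ Q) < trdeg k (R ⧸ P) := by
  have hp : (Q.map (Ideal.Quotient.mk P)).IsPrime := Ideal.isPrime_map_quotientMk_of_isPrime h.le
  have h0 : Q.map (Ideal.Quotient.mk P) ≠ ⊥ := by
    intro h0
    rw [Ideal.map_eq_bot_iff_le_ker, Ideal.mk_ker] at h0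
    exact h.not_ge h0
  have hlt := trdeg_quotient_lt (k := k) _ h0
  exact (DoubleQuot.quotQuotEquivQuotOfLEₐ k h.le).trdeg_eq.symm.trans_lt hlt

open Algebra in
theorem trdeg_quotient_minimalPrimes_sup {k R : Type} [Field k] [CommRing R] [Algebra k R]
    [Algebra.FiniteType k R] {P Q : Ideal R} [P.IsPrime] {h : R} (hh : h ∉ P)
    (hQ : Q ∈ (P ⊔ Ideal.span {h}).minimalPrimes) :
    trdeg k (R ⧸ Q) + 1 = trdeg k (R ⧸ P) := by
  have hle : P ≤ Q := le_sup_left.trans hQ.1.2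
  have hmem : Q.map (Ideal.Quotient.mk P) ∈ (Ideal.span {Ideal.Quotient.mk P h}).minimalPrimes := by
    have := Ideal.minimalPrimes_map_of_surjective (f := Ideal.Quotient.mk P)
      Ideal.Quotient.mk_surjective (Ideal.span {h})
    rw [Ideal.map_span, Set.image_singleton, Ideal.mk_ker, sup_comm] at this
    rw [this]
    exact ⟨Q, hQ, rfl⟩
  have h0 : Ideal.Quotient.mk P h ≠ 0 := by rwa [Ne, Ideal.Quotient.eq_zero_iff_mem]
  rw [← trdeg_quotient_minimalPrimes (k := k) h0 _ hmem]
  exact congrArg (· + 1) (DoubleQuot.quotQuotEquivQuotOfLEₐ k hle).trdeg_eq.symm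

open MvPolynomial

theorem isAlgebraicSet_zeroLocus {d : ℕ} (I : Ideal (MvPolynomial (Fin d) ℂ)) :
    IsAlgebraicSet (zeroLocus ℂ I) := by
  obtain ⟨S, rfl⟩ := (isNoetherianRing_iff_ideal_fg _).mp inferInstance I
  refine ⟨S, ?_⟩
  rw [zeroLocus_span]
  rfl

theorem IsAlgebraicSet.zeroLocus_vanishingIdeal {d : ℕ} {V : Set (Fin d → ℂ)}
    (hV : IsAlgebraicSet V) : zeroLocus ℂ (vanishingIdeal ℂ V) = V := by
  refine le_antisymm ?_ (zeroLocus_vanishingIdeal_le V)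
  obtain ⟨S, rfl⟩ := hV
  intro x hx P hP
  exact hx P fun y hy => hy P hP

theorem IsVariety.isPrime_vanishingIdeal {d : ℕ} {V : Set (Fin d → ℂ)} (hV : IsVariety V) :
    (vanishingIdeal ℂ V).IsPrime := by
  obtain ⟨hA, ⟨x, hx⟩, hirr⟩ := hV
  refine ⟨fun h => ?_, fun {f g} hfg => ?_⟩
  · have : (1 : MvPolynomial (Fin d) ℂ) ∈ vanishingIdeal ℂ V := by rw [h]; trivial
    simpa using this x hx
  · by_contra! hcon
    apply hirr
    have key : ∀ f : MvPolynomial (Fin d) ℂ, f ∉ vanishingIdeal ℂ V →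
        IsAlgebraicSet (zeroLocus ℂ (vanishingIdeal ℂ V ⊔ Ideal.span {f})) ∧
        zeroLocus ℂ (vanishingIdeal ℂ V ⊔ Ideal.span {f}) ⊂ V := by
      intro f hf
      refine ⟨isAlgebraicSet_zeroLocus _, ?_, fun hle => hf fun y hy => ?_⟩
      · refine (zeroLocus_anti_mono le_sup_left).trans ?_
        rw [hA.zeroLocus_vanishingIdeal]
      · exact hle hy f (Ideal.mem_sup_right (Ideal.mem_span_singleton_self f))
    refine ⟨_, _, (key f hcon.1).1, (key g hcon.2).1, (key f hcon.1).2, (key g hcon.2).2, ?_⟩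
    refine Set.Subset.antisymm (fun y hy => ?_)
      (Set.union_subset (key f hcon.1).2.1 (key g hcon.2).2.1)
    have hy0 := hfg y hy
    have hm : ∀ f : MvPolynomial (Fin d) ℂ, aeval y f = 0 →
        y ∈ zeroLocus ℂ (vanishingIdeal ℂ V ⊔ Ideal.span {f}) := by
      intro f hf p hp
      obtain ⟨a, ha, b, hb, rfl⟩ := Submodule.mem_sup.mp hp
      obtain ⟨c, rfl⟩ := Ideal.mem_span_singleton.mp hb
      rw [map_add, map_mul, hf, ha y hy]
      simp
    rw [map_mul] at hy0
    rcases mul_eq_zero.mp hy0 with h0 | h0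
    · exact Or.inl (hm f h0)
    · exact Or.inr (hm g h0)

theorem isVariety_zeroLocus {d : ℕ} (P : Ideal (MvPolynomial (Fin d) ℂ)) [hP : P.IsPrime] :
    IsVariety (zeroLocus ℂ P) := by
  refine ⟨isAlgebraicSet_zeroLocus P, ?_, ?_⟩
  · by_contra hne
    rw [Set.not_nonempty_iff_eq_empty] at hne
    have := IsPrime.vanishingIdeal_zeroLocus (K := ℂ) P
    rw [hne, vanishingIdeal_empty] at this
    exact hP.ne_top this.symm
  · rintro ⟨A, B, hA, hB, hAV, hBV, hU⟩
    have key : ∀ A : Set (Fin d → ℂ), IsAlgebraicSet A → A ⊂ zeroLocus ℂ P →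
        ∃ f, f ∉ P ∧ ∀ x ∈ A, aeval x f = 0 := by
      intro A hA hAV
      by_contra! hcon
      refine hAV.2 ?_
      rw [← hA.zeroLocus_vanishingIdeal]
      refine zeroLocus_anti_mono fun f hf => ?_
      by_contra hfP
      obtain ⟨x, hx, hx0⟩ := hcon f hfP
      exact hx0 (hf x hx)
    obtain ⟨f, hf, hfA⟩ := key A hA hAV
    obtain ⟨g, hg, hgB⟩ := key B hB hBV
    have : f * g ∈ P := by
      rw [← IsPrime.vanishingIdeal_zeroLocus (K := ℂ) P, hU]
      rintro x (hx | hx)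
      · rw [map_mul, hfA x hx, zero_mul]
      · rw [map_mul, hgB x hx, mul_zero]
    exact (hP.mem_or_mem this).elim hf hg

theorem vanishingIdeal_lt_of_ssubset {d : ℕ} {V W : Set (Fin d → ℂ)} (hV : IsAlgebraicSet V)
    (hW : IsAlgebraicSet W) (h : V ⊂ W) : vanishingIdeal ℂ W < vanishingIdeal ℂ V := by
  refine lt_of_le_not_ge (vanishingIdeal_anti_mono h.1) fun hle => h.2 ?_
  rw [← hV.zeroLocus_vanishingIdeal, ← hW.zeroLocus_vanishingIdeal]
  exact zeroLocus_anti_mono hle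

/-- Cutting by a hypersurface that meets the variety without containing it lowers the transcendence
degree by exactly one, so a component of the section supplies the rest of the chain by induction. -/
theorem exists_chain_of_trdeg {d : ℕ} (r : ℕ) : ∀ (P : Ideal (MvPolynomial (Fin d) ℂ)) [P.IsPrime],
    Algebra.trdeg ℂ (MvPolynomial (Fin d) ℂ ⧸ P) = r →
    ∃ c : Fin (r + 1) → Set (Fin d → ℂ),
      StrictMono c ∧ (∀ i, IsVariety (c i)) ∧ c (Fin.last r) = zeroLocus ℂ P := by
  induction r with
  | zero =>
    intro P _ _
    exact ⟨fun _ => zeroLocus ℂ P, by simp [Fin.strictMono_iff_lt_succ], fun _ => isVariety_zeroLocus P, rfl⟩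
  | succ r ih =>
    intro P hP htr
    -- Positive transcendence degree prevents P from being maximal. Any element of a larger maximal
    -- ideal outside P serves as h.
    obtain ⟨h, hh, hne⟩ : ∃ h, h ∉ P ∧ P ⊔ Ideal.span {h} ≠ ⊤ := by
      obtain ⟨M, hM, hPM⟩ := P.exists_le_maximal hP.ne_top
      obtain ⟨h, hhM, hhP⟩ : ∃ h ∈ M, h ∉ P := by
        by_contra! hcon
        have : P = M := le_antisymm hPM hcon
        subst this
        have hintegral : Algebra.IsIntegral ℂ (MvPolynomial (Fin d) ℂ ⧸ P) := by
          let := Ideal.Quotient.field P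
          have := finite_of_finite_type_of_isJacobsonRing ℂ (MvPolynomial (Fin d) ℂ ⧸ P)
          infer_instance
        rw [trdeg_eq_zero] at htr
        norm_cast at htr
      refine ⟨h, hhP, fun htop => hM.ne_top (top_le_iff.mp ?_)⟩
      rw [← htop]
      exact sup_le hPM ((Ideal.span_singleton_le_iff_mem _).mpr hhM)
    obtain ⟨Q, hQ⟩ := Ideal.nonempty_minimalPrimes hne
    have hQp : Q.IsPrime := hQ.isPrime
    have htQ := trdeg_quotient_minimalPrimes_sup (k := ℂ) hh hQ
    rw [htr] at htQ
    have htQ' : Algebra.trdeg ℂ (MvPolynomial (Fin d) ℂ ⧸ Q) = r := by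
      obtain ⟨m, hm⟩ := Cardinal.lt_aleph0.mp (trdeg_lt_aleph0_of_finiteType (R := ℂ)
        (S := MvPolynomial (Fin d) ℂ ⧸ Q))
      rw [hm] at htQ ⊢
      norm_cast at htQ ⊢
      omega
    obtain ⟨c, hc, hcv, hcl⟩ := ih Q htQ'
    have hPQ : P < Q := lt_of_le_of_ne (le_sup_left.trans hQ.1.2) fun heq => hh (by
      rw [heq]; exact hQ.1.2 (Ideal.mem_sup_right (Ideal.mem_span_singleton_self h)))
    have hlt : zeroLocus ℂ Q < zeroLocus ℂ P := by
      refine lt_of_le_not_ge (zeroLocus_anti_mono hPQ.le) fun hle => hPQ.not_ge ?_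
      rw [← IsPrime.vanishingIdeal_zeroLocus (K := ℂ) P,
        ← IsPrime.vanishingIdeal_zeroLocus (K := ℂ) Q]
      exact vanishingIdeal_anti_mono hle
    refine ⟨Fin.snoc c (zeroLocus ℂ P), ?_, ?_, by simp⟩
    · refine Fin.strictMono_iff_lt_succ.mpr fun i => ?_
      induction i using Fin.lastCases with
      | last => rw [Fin.succ_last, Fin.snoc_last, Fin.snoc_castSucc, hcl]; exact hlt
      | cast i =>
        rw [← Fin.castSucc_succ, Fin.snoc_castSucc, Fin.snoc_castSucc]
        exact hc (Fin.castSucc_lt_succ)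
    · intro i
      induction i using Fin.lastCases with
      | last => rw [Fin.snoc_last]; exact isVariety_zeroLocus P
      | cast i => rw [Fin.snoc_castSucc]; exact hcv i

/-- Each strict inclusion of varieties raises the transcendence degree by at least one. This is the
upper bound on chain lengths that matches `exists_chain_of_trdeg`. -/
theorem le_trdeg_of_chain {d : ℕ} (s : ℕ) (c : Fin (s + 1) → Set (Fin d → ℂ)) (hc : StrictMono c)
    (hv : ∀ i, IsVariety (c i)) (i : Fin (s + 1)) :
    ((i : ℕ) : Cardinal) ≤
      Algebra.trdeg ℂ (MvPolynomial (Fin d) ℂ ⧸ vanishingIdeal ℂ (c i)) := by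
  induction i using Fin.induction with
  | zero => simp
  | succ i ih =>
    have := (hv i.castSucc).isPrime_vanishingIdeal
    have := (hv i.succ).isPrime_vanishingIdeal
    have hlt := trdeg_quotient_lt_of_lt (k := ℂ)
      (vanishingIdeal_lt_of_ssubset (hv i.castSucc).1 (hv i.succ).1 (hc (Fin.castSucc_lt_succ)))
    have := Order.succ_le_of_lt (ih.trans_lt hlt)
    simpa using this

theorem hasDim_zeroLocus {d r : ℕ} (P : Ideal (MvPolynomial (Fin d) ℂ)) [P.IsPrime]
    (h : Algebra.trdeg ℂ (MvPolynomial (Fin d) ℂ ⧸ P) = r) : HasDim (zeroLocus ℂ P) r := by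
  refine ⟨exists_chain_of_trdeg r P h, ?_⟩
  rintro s ⟨c, hc, hv, hl⟩
  have := le_trdeg_of_chain s c hc hv (Fin.last s)
  rw [hl, IsPrime.vanishingIdeal_zeroLocus (K := ℂ) P, h] at this
  exact_mod_cast this

theorem HasDim.trdeg_eq {d r : ℕ} {P : Ideal (MvPolynomial (Fin d) ℂ)} [P.IsPrime]
    (h : HasDim (zeroLocus ℂ P) r) : Algebra.trdeg ℂ (MvPolynomial (Fin d) ℂ ⧸ P) = r := by
  obtain ⟨m, hm⟩ := Cardinal.lt_aleph0.mp (trdeg_lt_aleph0_of_finiteType (R := ℂ)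
    (S := MvPolynomial (Fin d) ℂ ⧸ P))
  rw [hm, (hasDim_zeroLocus P hm).unique h]

/-! ### Generic linear slices -/

/-- The family consisting of the entries of a generic matrix `A` with rows indexed by `κ`,
together with the linear forms `(A x) (e i)` in the coordinates `x`. -/
noncomputable def sliceVec {R ι κ : Type} [CommRing R] {d : ℕ} (e : ι → κ) (x : Fin d → R) :
    (κ × Fin d) ⊕ ι → MvPolynomial (κ × Fin d) R :=
  Sum.elim X (fun i => ∑ j, X (e i, j) * C (x j))

/-- The proof degenerates the generic matrix A to A₀ + T·A, where row `e i` of A₀ selects the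
coordinate `J i`. A relation between A and Ax becomes one between A₀ + T·A and x_J + T·Ax. Dividing
by the largest power of T and setting T = 0 leaves a nonzero relation between the entries of A and
the x_J, which are independent. -/
theorem sliceVec_algebraicIndependent {R ι κ : Type} [CommRing R] [IsDomain R] [Algebra ℂ R]
    {d : ℕ} (e : ι → κ) (he : Function.Injective e) (x : Fin d → R) (J : ι → Fin d)
    (hJ : AlgebraicIndependent ℂ (x ∘ J)) : AlgebraicIndependent ℂ (sliceVec e x) := by
  classical
  have hbase : AlgebraicIndependent ℂ (Sum.elim (X : κ × Fin d → MvPolynomial (κ × Fin d) R)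
      (algebraMap R (MvPolynomial (κ × Fin d) R) ∘ (x ∘ J))) :=
    hJ.sumElim_comp (algebraicIndependent_X _ _)
  let A₀ : κ × Fin d → ℂ := fun a => if ∃ i, e i = a.1 ∧ J i = a.2 then 1 else 0
  have hA₀ : ∀ i j, A₀ (e i, j) = if J i = j then 1 else 0 := by
    intro i j
    refine if_congr ⟨?_, fun h => ⟨i, rfl, h⟩⟩ rfl rfl
    rintro ⟨i', h1, h2⟩
    rw [← he h1]; exact h2
  let T := (κ × Fin d) ⊕ ι
  let Φ : MvPolynomial T ℂ →ₐ[ℂ] Polynomial (MvPolynomial T ℂ) :=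
    aeval (Sum.elim (fun a => Polynomial.C (C (A₀ a)) + Polynomial.X * Polynomial.C (X (Sum.inl a)))
      (fun i => Polynomial.C (X (Sum.inr i))))
  let ψ : MvPolynomial T ℂ →ₐ[ℂ] Polynomial (MvPolynomial (κ × Fin d) R) :=
    aeval (Sum.elim (fun a => Polynomial.C (X a))
      (fun i => Polynomial.C (C (x (J i))) +
        Polynomial.X * Polynomial.C (∑ j, X (e i, j) * C (x j))))
  let Ψ : Polynomial (MvPolynomial T ℂ) →+* Polynomial (MvPolynomial (κ × Fin d) R) :=
    Polynomial.eval₂RingHom ψ.toRingHom Polynomial.X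
  let χ : MvPolynomial (κ × Fin d) R →ₐ[R] Polynomial (MvPolynomial (κ × Fin d) R) :=
    aeval (fun a => Polynomial.C (C (algebraMap ℂ R (A₀ a))) + Polynomial.X * Polynomial.C (X a))
  have hcomp : ∀ P, Ψ (Φ P) = χ (aeval (sliceVec e x) P) := by
    intro P
    have : Ψ.comp Φ.toRingHom = χ.toRingHom.comp (aeval (R := ℂ) (sliceVec e x)).toRingHom := by
      apply MvPolynomial.ringHom_ext
      · intro r
        simp [Φ, Ψ, χ, ψ, MvPolynomial.algebraMap_apply, Polynomial.algebraMap_apply]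
      · rintro (a | i)
        · simp [Φ, Ψ, χ, ψ, sliceVec, MvPolynomial.algebraMap_apply, Polynomial.algebraMap_apply]
        · simp [Φ, Ψ, χ, ψ, sliceVec, hA₀, add_mul, Finset.sum_add_distrib, apply_ite,
            Finset.mul_sum, mul_assoc, Polynomial.algebraMap_apply, MvPolynomial.algebraMap_eq]
          exact Finset.sum_congr rfl fun _ _ => by ring
    exact congrArg (fun f => f P) this
  have hcomp0 : ∀ G, (Ψ G).coeff 0 =
      aeval (Sum.elim (X : κ × Fin d → MvPolynomial (κ × Fin d) R)
      (algebraMap R (MvPolynomial (κ × Fin d) R) ∘ (x ∘ J))) (G.coeff 0) := by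
    intro G
    have : (Polynomial.constantCoeff).comp Ψ = (aeval (R := ℂ) (Sum.elim
        (X : κ × Fin d → MvPolynomial (κ × Fin d) R)
        (algebraMap R (MvPolynomial (κ × Fin d) R) ∘ (x ∘ J)))).toRingHom.comp
        Polynomial.constantCoeff := by
      apply Polynomial.ringHom_ext
      · intro P
        have h2 : (Polynomial.constantCoeff).comp ψ.toRingHom = (aeval (R := ℂ) (Sum.elim
            (X : κ × Fin d → MvPolynomial (κ × Fin d) R)
            (algebraMap R (MvPolynomial (κ × Fin d) R) ∘ (x ∘ J)))).toRingHom := by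
          apply MvPolynomial.ringHom_ext
          · intro r
            simp [ψ, MvPolynomial.algebraMap_eq, Polynomial.algebraMap_apply]
          · rintro (a | i)
            · simp [ψ]
            · simp [ψ, MvPolynomial.algebraMap_eq]
        simpa [Ψ] using congrArg (fun f => f P) h2
      · simp [Ψ]
    exact congrArg (fun f => f G) this
  refine (injective_iff_map_eq_zero _).mpr fun P hP => ?_
  by_contra hP0
  have hΦ : Φ P ≠ 0 := by
    intro h0
    apply hP0
    apply MvPolynomial.funext
    intro z
    let z' : T → ℂ := Sum.elim (fun a => z (Sum.inl a) - A₀ a) (fun i => z (Sum.inr i))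
    have h3 : ((eval z').comp (Polynomial.evalRingHom 1)).comp Φ.toRingHom = eval z := by
      apply MvPolynomial.ringHom_ext
      · intro r; simp [Φ]
      · rintro (a | i) <;> simp [Φ, z']
    rw [← h3]
    simp [h0]
  -- Here `Polynomial.X` plays the role of T, and G is what remains of `Φ P` after removing its
  -- power.
  obtain ⟨G, hG, hGd⟩ := Polynomial.exists_eq_pow_rootMultiplicity_mul_and_not_dvd _ hΦ 0
  rw [Polynomial.C_0, sub_zero] at hG hGd
  rw [Polynomial.X_dvd_iff] at hGd
  have h1 := hcomp P
  rw [hP, map_zero, hG, map_mul, map_pow] at h1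
  have hX : Ψ Polynomial.X = Polynomial.X := by simp [Ψ]
  rw [hX, mul_eq_zero, or_iff_right (pow_ne_zero _ Polynomial.X_ne_zero)] at h1
  have h2 := hcomp0 G
  rw [h1, Polynomial.coeff_zero] at h2
  exact hGd ((injective_iff_map_eq_zero _).mp hbase _ h2.symm)

/-- Any generating set contains a transcendence basis, whose size is the transcendence degree. -/
theorem exists_coordinates_algebraicIndependent {R ι : Type} [CommRing R] [IsDomain R] [Algebra ℂ R]
    [Fintype ι] {d : ℕ} (x : Fin d → R) (hx : Algebra.adjoin ℂ (Set.range x) = ⊤)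
    (hι : Algebra.trdeg ℂ R = Fintype.card ι) :
    ∃ J : ι → Fin d, AlgebraicIndependent ℂ (x ∘ J) := by
  have : Algebra.IsAlgebraic (Algebra.adjoin ℂ (Set.range x)) R := by
    refine ⟨fun a => ?_⟩
    exact isAlgebraic_algebraMap (A := R) (⟨a, by rw [hx]; trivial⟩ :
      Algebra.adjoin ℂ (Set.range x))
  obtain ⟨t, ht, hb⟩ := exists_isTranscendenceBasis_subset (R := ℂ) (Set.range x)
  have hc := hb.cardinalMk_eq_trdeg
  rw [hι, ← Cardinal.mk_fintype, Cardinal.eq] at hc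
  obtain ⟨E⟩ := hc
  choose J hJ using fun a : t => ht a.2
  refine ⟨fun i => J (E.symm i), ?_⟩
  have h2 := hb.1.comp E.symm E.symm.injective
  convert h2 using 1
  funext i
  exact hJ (E.symm i)

theorem sliceVec_isTranscendenceBasis {R ι κ : Type} [CommRing R] [IsDomain R] [Algebra ℂ R]
    [Fintype ι] [Fintype κ] {d : ℕ} (e : ι → κ) (he : Function.Injective e) (x : Fin d → R)
    (hx : Algebra.adjoin ℂ (Set.range x) = ⊤) (hι : Algebra.trdeg ℂ R = Fintype.card ι) :
    IsTranscendenceBasis ℂ (sliceVec e x) := by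
  obtain ⟨J, hJ⟩ := exists_coordinates_algebraicIndependent x hx hι
  refine (sliceVec_algebraicIndependent e he x J hJ).isTranscendenceBasis_of_trdeg_le_of_finite ?_
  rw [← trdeg_add_eq ℂ R (A := MvPolynomial (κ × Fin d) R), hι]
  simp [add_comm]

/-- The coordinate functions on the affine variety cut out by `P`. -/
noncomputable def coordFun {d : ℕ} (P : Ideal (MvPolynomial (Fin d) ℂ)) (j : Fin d) :
    MvPolynomial (Fin d) ℂ ⧸ P :=
  Ideal.Quotient.mk P (X j)

theorem adjoin_coordFun {d : ℕ} (P : Ideal (MvPolynomial (Fin d) ℂ)) :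
    Algebra.adjoin ℂ (Set.range (coordFun P)) = ⊤ := by
  rw [Algebra.adjoin_range_eq_range_aeval, AlgHom.range_eq_top]
  intro a
  obtain ⟨p, rfl⟩ := Ideal.Quotient.mk_surjective a
  refine ⟨p, ?_⟩
  have : aeval (coordFun P) = Ideal.Quotient.mkₐ ℂ P := by ext j; simp [coordFun]
  rw [this]; rfl

theorem aeval_coordFun {d : ℕ} (P : Ideal (MvPolynomial (Fin d) ℂ)) (p : MvPolynomial (Fin d) ℂ) :
    aeval (coordFun P) p = Ideal.Quotient.mk P p := by
  have : aeval (coordFun P) = Ideal.Quotient.mkₐ ℂ P := by ext j; simp [coordFun]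
  rw [this]; rfl

/-- The affine subspace of `ℂ^d` cut out by the rows `e i` of the matrix part of `z`, with the
vector part of `z` as right-hand side. -/
def slice {ι κ : Type} {d : ℕ} (e : ι → κ) (z : (κ × Fin d) ⊕ ι → ℂ) : Set (Fin d → ℂ) :=
  {x | ∀ i, ∑ j, z (Sum.inl (e i, j)) * x j = z (Sum.inr i)}

/-- Evaluation of functions on `W × ℂ^(κ × d)` at a point. -/
noncomputable def pointEval {κ : Type} {d : ℕ} (P : Ideal (MvPolynomial (Fin d) ℂ))
    (x : Fin d → ℂ) (hx : x ∈ zeroLocus ℂ P) (A : κ × Fin d → ℂ) :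
    MvPolynomial (κ × Fin d) (MvPolynomial (Fin d) ℂ ⧸ P) →ₐ[ℂ] ℂ :=
  { eval₂Hom (Ideal.Quotient.lift P (aeval (R := ℂ) x).toRingHom hx) A with
    commutes' := fun r => by
      simp [MvPolynomial.algebraMap_apply, ← Ideal.Quotient.mk_algebraMap] }

theorem pointEval_C_mk {κ : Type} {d : ℕ} (P : Ideal (MvPolynomial (Fin d) ℂ))
    (x : Fin d → ℂ) (hx : x ∈ zeroLocus ℂ P) (A : κ × Fin d → ℂ) (p : MvPolynomial (Fin d) ℂ) :
    pointEval P x hx A (C (Ideal.Quotient.mk P p)) = aeval x p := by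
  change eval₂Hom (Ideal.Quotient.lift P (aeval (R := ℂ) x).toRingHom hx) A _ = _
  simp

theorem pointEval_X {κ : Type} {d : ℕ} (P : Ideal (MvPolynomial (Fin d) ℂ))
    (x : Fin d → ℂ) (hx : x ∈ zeroLocus ℂ P) (A : κ × Fin d → ℂ) (a : κ × Fin d) :
    pointEval P x hx A (X a) = A a := by
  change eval₂Hom (Ideal.Quotient.lift P (aeval (R := ℂ) x).toRingHom hx) A _ = _
  simp

theorem pointEval_sliceVec {ι κ : Type} {d : ℕ} (P : Ideal (MvPolynomial (Fin d) ℂ))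
    (e : ι → κ) (x : Fin d → ℂ) (hx : x ∈ zeroLocus ℂ P) (A : κ × Fin d → ℂ)
    (G : MvPolynomial ((κ × Fin d) ⊕ ι) ℂ) :
    pointEval P x hx A (aeval (sliceVec e (coordFun P)) G) =
      eval (Sum.elim A fun i => ∑ j, A (e i, j) * x j) G := by
  rw [comp_aeval_apply, ← aeval_eq_eval]
  congr 2
  funext t
  rcases t with a | i
  · simp [sliceVec, pointEval_X]
  · simp [sliceVec, pointEval_X, coordFun, pointEval_C_mk]

theorem aeval_ringHom_coordFun {ι κ : Type} {d : ℕ} {P : Ideal (MvPolynomial (Fin d) ℂ)}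
    {e : ι → κ} {z : (κ × Fin d) ⊕ ι → ℂ}
    {τ : MvPolynomial (κ × Fin d) (MvPolynomial (Fin d) ℂ ⧸ P) →+* ℂ}
    (hτ : τ.comp (aeval (R := ℂ) (sliceVec e (coordFun P))).toRingHom = eval z)
    (p : MvPolynomial (Fin d) ℂ) :
    aeval (fun j => τ (C (coordFun P j))) p = τ (C (Ideal.Quotient.mk P p)) := by
  have : (aeval (R := ℂ) (fun j => τ (C (coordFun P j)))).toRingHom =
      (τ.comp C).comp (Ideal.Quotient.mk P) := by
    apply MvPolynomial.ringHom_ext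
    · intro r
      have h1 : τ (aeval (R := ℂ) (sliceVec e (coordFun P)) (C r)) = eval z (C r) :=
        congrArg (fun f => f (C r)) hτ
      rw [algHom_C, eval_C] at h1
      change aeval (R := ℂ) (fun j => τ (C (coordFun P j))) (C r) = _
      rw [algHom_C]
      exact h1.symm
    · intro j; simp [coordFun]
  exact congrArg (fun f => f p) this

theorem ringHom_X_eq {ι κ : Type} {d : ℕ} {P : Ideal (MvPolynomial (Fin d) ℂ)}
    {e : ι → κ} {z : (κ × Fin d) ⊕ ι → ℂ}
    {τ : MvPolynomial (κ × Fin d) (MvPolynomial (Fin d) ℂ ⧸ P) →+* ℂ}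
    (hτ : τ.comp (aeval (R := ℂ) (sliceVec e (coordFun P))).toRingHom = eval z) (a : κ × Fin d) :
    τ (X a) = z (Sum.inl a) := by
  have h1 : τ (aeval (R := ℂ) (sliceVec e (coordFun P)) (X (Sum.inl a))) =
    eval z (X (Sum.inl a)) := congrArg (fun f => f (X (Sum.inl a))) hτ
  simpa [sliceVec] using h1

/-- Points of a fibre correspond to ring homomorphisms. -/
noncomputable def fiberEquiv {ι κ : Type} {d : ℕ} (P : Ideal (MvPolynomial (Fin d) ℂ))
    (e : ι → κ) (z : (κ × Fin d) ⊕ ι → ℂ) :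
    {τ : MvPolynomial (κ × Fin d) (MvPolynomial (Fin d) ℂ ⧸ P) →+* ℂ //
      τ.comp (aeval (R := ℂ) (sliceVec e (coordFun P))).toRingHom = eval z} ≃
    (zeroLocus ℂ P ∩ slice e z : Set (Fin d → ℂ)) where
  toFun τ := ⟨fun j => τ.1 (C (coordFun P j)), by
    constructor
    · intro p hp
      rw [aeval_ringHom_coordFun τ.2, Ideal.Quotient.eq_zero_iff_mem.mpr hp, map_zero, map_zero]
    · intro i
      have h1 : τ.1 (aeval (R := ℂ) (sliceVec e (coordFun P)) (X (Sum.inr i))) =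
        eval z (X (Sum.inr i)) := congrArg (fun f => f (X (Sum.inr i))) τ.2
      simpa [sliceVec, ringHom_X_eq τ.2] using h1⟩
  invFun x := ⟨(pointEval P x.1 x.2.1 fun a => z (Sum.inl a)).toRingHom, RingHom.ext fun G => by
    refine (pointEval_sliceVec P e x.1 x.2.1 _ G).trans ?_
    congr 2
    funext t
    rcases t with a | i
    · rfl
    · exact x.2.2 i⟩
  left_inv τ := by
    apply Subtype.ext
    apply MvPolynomial.ringHom_ext
    · intro r
      obtain ⟨p, rfl⟩ := Ideal.Quotient.mk_surjective r
      exact (pointEval_C_mk _ _ _ _ _).trans (aeval_ringHom_coordFun τ.2 p)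
    · intro a
      exact (pointEval_X _ _ _ _ _).trans (ringHom_X_eq τ.2 a).symm
  right_inv x := by
    apply Subtype.ext
    funext j
    exact (pointEval_C_mk _ _ _ _ _).trans (aeval_X _ _)

/-- By `sliceVec_isTranscendenceBasis`, the map (x, A) ↦ (A, Ax restricted to the rows in `e`) is
generically finite with polynomial base. The number n is the degree of its function field extension.
It serves at once as the number of points in a generic slice and as a degree bound for relations,
which is how the geometric degree controls the Chow form. -/
theorem exists_slice_data {ι κ : Type} [Fintype ι] [Fintype κ] {d : ℕ}
    (P : Ideal (MvPolynomial (Fin d) ℂ)) [P.IsPrime] (e : ι → κ) (he : Function.Injective e)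
    (hP : Algebra.trdeg ℂ (MvPolynomial (Fin d) ℂ ⧸ P) = Fintype.card ι) :
    ∃ n : ℕ, 1 ≤ n ∧
      (∃ g : MvPolynomial ((κ × Fin d) ⊕ ι) ℂ, g ≠ 0 ∧
        ∀ z, eval z g ≠ 0 → (zeroLocus ℂ P ∩ slice e z).encard = n) ∧
      (∀ θ : MvPolynomial (κ × Fin d) (MvPolynomial (Fin d) ℂ ⧸ P),
        ∃ F : Polynomial (MvPolynomial ((κ × Fin d) ⊕ ι) ℂ), Prime F ∧ 0 < F.natDegree ∧
          F.natDegree ≤ n ∧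
          F.eval₂ (aeval (R := ℂ) (sliceVec e (coordFun P))).toRingHom θ = 0 ∧
          ∀ G : Polynomial (MvPolynomial ((κ × Fin d) ⊕ ι) ℂ),
            G.eval₂ (aeval (R := ℂ) (sliceVec e (coordFun P))).toRingHom θ = 0 → F ∣ G) ∧
      (∀ t : MvPolynomial (κ × Fin d) (MvPolynomial (Fin d) ℂ ⧸ P), t ≠ 0 →
        ∃ b : MvPolynomial ((κ × Fin d) ⊕ ι) ℂ, b ≠ 0 ∧
          t ∣ aeval (R := ℂ) (sliceVec e (coordFun P)) b) := by
  let R := MvPolynomial (Fin d) ℂ ⧸ P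
  let B := MvPolynomial ((κ × Fin d) ⊕ ι) ℂ
  let S := MvPolynomial (κ × Fin d) R
  have hb := sliceVec_isTranscendenceBasis e he (coordFun P) (adjoin_coordFun P) hP
  let φ : B →ₐ[ℂ] S := aeval (sliceVec e (coordFun P))
  let algBS : Algebra B S := φ.toRingHom.toAlgebra
  have htow : IsScalarTower ℂ B S := IsScalarTower.of_algebraMap_eq' φ.comp_algebraMap.symm
  have hfaith : FaithfulSMul B S := (faithfulSMul_iff_algebraMap_injective _ _).mpr hb.1
  have halg : Algebra.IsAlgebraic B S := by
    have h1 := hb.isAlgebraic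
    refine ⟨fun s => ?_⟩
    -- The transcendence basis gives algebraicity over the subalgebra it generates. The coefficients
    -- are transported to B through the isomorphism of B with that subalgebra.
    obtain ⟨p, hp0, hp⟩ := h1.isAlgebraic s
    let E := hb.1.aevalEquiv
    refine ⟨p.map E.symm.toRingEquiv.toRingHom, ?_, ?_⟩
    · rwa [Ne, Polynomial.map_eq_zero_iff E.symm.injective]
    · rw [Polynomial.aeval_def, Polynomial.eval₂_map]
      rw [Polynomial.aeval_def] at hp
      rw [← hp]
      congr 1
      refine RingHom.ext fun a => ?_
      obtain ⟨b, rfl⟩ := E.surjective a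
      change φ (E.symm (E b)) = ((E b : Algebra.adjoin ℂ (Set.range _)) : S)
      rw [AlgEquiv.symm_apply_apply]
      exact (hb.1.algebraMap_aevalEquiv b).symm
  have hft : Algebra.FiniteType B S := by
    have : Algebra.FiniteType ℂ S := Algebra.FiniteType.trans (S := R) inferInstance inferInstance
    exact Algebra.FiniteType.of_restrictScalars_finiteType ℂ B S
  let K := FractionRing B
  let L := FractionRing S
  have hSL : FaithfulSMul S L :=
    (faithfulSMul_iff_algebraMap_injective S L).mpr (IsFractionRing.injective S L)
  have hBL : FaithfulSMul B L := FaithfulSMul.trans B S L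
  let algKL : Algebra K L := FractionRing.liftAlgebra B L
  have hKL : IsScalarTower B K L := FractionRing.isScalarTower_liftAlgebra B L
  have hcz : CharZero K := charZero_of_injective_algebraMap (IsFractionRing.injective B K)
  have hfin : Module.Finite K L := finite_fractionField_of_isAlgebraic B S K L
  obtain ⟨g, hg0, hg⟩ := exists_card_fiber_eq_finrank B S K L
  refine ⟨Module.finrank K L, Module.finrank_pos, ⟨g, hg0, fun z hz => ?_⟩, fun θ => ?_,
    fun t ht => ?_⟩
  · have h1 := hg (eval z) hz
    have h2 : Nat.card (zeroLocus ℂ P ∩ slice e z : Set (Fin d → ℂ)) = Module.finrank K L := by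
      rw [← h1]
      exact (Nat.card_congr (fiberEquiv P e z)).symm
    have hpos : 0 < Module.finrank K L := Module.finrank_pos
    rw [← h2] at hpos
    have := (Nat.card_pos_iff.mp hpos).2
    rw [← h2, Set.encard, ENat.card_eq_coe_natCard]
  · exact exists_prime_generator_relations K L θ
  · obtain ⟨b, hb, t', h⟩ := exists_mul_eq_algebraMap_of_isAlgebraic (B := B) t ht
    exact ⟨b, hb, t', h.symm⟩

/-! ### From generic slices to almost every slice -/

/-- Fubini and induction on the number of variables: for all but finitely many values of the first
variable the specialized polynomial is still nonzero. -/
theorem ae_eval_ne_zero : ∀ {n : ℕ} {p : MvPolynomial (Fin n) ℂ}, p ≠ 0 →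
    ∀ᵐ z : Fin n → ℂ, eval z p ≠ 0
  | 0, p, hp => by
    refine Filter.Eventually.of_forall fun z hz => hp ?_
    apply MvPolynomial.funext
    intro y
    rw [Subsingleton.elim y z, hz, map_zero]
  | n + 1, p, hp => by
    have hmp := volume_preserving_piFinSuccAbove (fun _ : Fin (n + 1) => ℂ) 0
    have hcont : Continuous fun q : ℂ × (Fin n → ℂ) =>
        eval (Fin.cons q.1 q.2 : Fin (n + 1) → ℂ) p :=
      (MvPolynomial.continuous_eval p).comp
        (continuous_pi fun i => by
          induction i using Fin.cases with
          | zero => exact continuous_fst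
          | succ i => exact (continuous_apply i).comp continuous_snd)
    have key : ∀ᵐ q : ℂ × (Fin n → ℂ), eval (Fin.cons q.1 q.2 : Fin (n + 1) → ℂ) p ≠ 0 := by
      have hmeas : MeasurableSet {q : ℂ × (Fin n → ℂ) |
          eval (Fin.cons q.1 q.2 : Fin (n + 1) → ℂ) p ≠ 0} :=
        hcont.measurable (measurableSet_singleton (0 : ℂ)).compl
      rw [Measure.volume_eq_prod, Measure.ae_prod_iff_ae_ae hmeas]
      have hF : finSuccEquiv ℂ n p ≠ 0 := by simpa using hp
      have hfin : {a : ℂ | (finSuccEquiv ℂ n p).eval (C a) = 0}.Finite :=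
        Set.Finite.preimage (f := C) (C_injective _ _).injOn
          (Polynomial.finite_setOfPred_isRoot hF)
      have hae : ∀ᵐ a : ℂ, a ∉ {a : ℂ | (finSuccEquiv ℂ n p).eval (C a) = 0} :=
        hfin.countable.ae_notMem volume
      filter_upwards [hae] with a ha
      filter_upwards [ae_eval_ne_zero (p := (finSuccEquiv ℂ n p).eval (C a)) ha] with y hy
      rw [eval_eq_eval_mv_eval', Polynomial.eval_map]
      rw [← Polynomial.eval₂_hom] at hy
      simpa using hy
    have h2 := hmp.quasiMeasurePreserving.ae key
    filter_upwards [h2] with z hz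
    convert hz using 3
    funext i
    induction i using Fin.cases with
    | zero => rfl
    | succ i => rfl

theorem isAddHaarMeasure_volume_slices (r d : ℕ) :
    (volume : Measure ((Fin r → Fin d → ℂ) × (Fin r → ℂ))).IsAddHaarMeasure := by
  have h1 : ∀ m, (volume : Measure (Fin m → ℂ)).IsAddHaarMeasure := fun m =>
    Measure.pi.isAddHaarMeasure _
  have h2 : (volume : Measure (Fin r → Fin d → ℂ)).IsAddHaarMeasure := by
    have := h1 d
    exact Measure.pi.isAddHaarMeasure _
  have h3 := h1 r
  exact Measure.prod.instIsAddHaarMeasure _ _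

/-- The point of the parameter space corresponding to a matrix and a vector. -/
def slicePoint {r d : ℕ} (L : (Fin r → Fin d → ℂ) × (Fin r → ℂ)) : (Fin r × Fin d) ⊕ Fin r → ℂ :=
  Sum.elim (fun a => L.1 a.1 a.2) L.2

theorem ae_eval_slicePoint_ne_zero {r d : ℕ} {p : MvPolynomial ((Fin r × Fin d) ⊕ Fin r) ℂ}
    (hp : p ≠ 0) :
    ∀ᵐ L : (Fin r → Fin d → ℂ) × (Fin r → ℂ), eval (slicePoint L) p ≠ 0 := by
  let E := Fintype.equivFin ((Fin r × Fin d) ⊕ Fin r)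
  -- Flattening the parameters is a linear isomorphism, so it carries Lebesgue measure to a Haar
  -- measure, which has the same null sets as Lebesgue measure on the target.
  let T : ((Fin r → Fin d → ℂ) × (Fin r → ℂ)) ≃ₗ[ℝ]
      (Fin (Fintype.card ((Fin r × Fin d) ⊕ Fin r)) → ℂ) :=
    { toFun := fun L i => slicePoint L (E.symm i)
      map_add' := fun L L' => by
        funext i
        rcases h : E.symm i with a | a <;> simp [slicePoint, h]
      map_smul' := fun c L => by
        funext i
        rcases h : E.symm i with a | a <;> simp [slicePoint, h]
      invFun := fun y => (fun i j => y (E (Sum.inl (i, j))), fun i => y (E (Sum.inr i)))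
      left_inv := fun L => by simp [slicePoint]
      right_inv := fun y => by
        funext i
        obtain ⟨t, rfl⟩ := E.surjective i
        rcases t with a | a <;> simp [slicePoint] }
  let T' := T.toContinuousLinearEquiv
  have hne : rename E p ≠ 0 := by
    rwa [Ne, map_eq_zero_iff _ (rename_injective _ E.injective)]
  have hH := isAddHaarMeasure_volume_slices r d
  have hmap : (Measure.map T' volume).IsAddHaarMeasure := T'.isAddHaarMeasure_map volume
  have hac : Measure.map T' volume ≪ volume := Measure.absolutelyContinuous_isAddHaarMeasure _ _
  have h1 := ae_of_ae_map T'.continuous.measurable.aemeasurable (hac.ae_le (ae_eval_ne_zero hne))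
  filter_upwards [h1] with L hL
  rw [eval_rename] at hL
  convert hL using 3
  funext t
  exact congrArg (slicePoint L) (E.symm_apply_apply t).symm

theorem slice_slicePoint {r d : ℕ} (L : (Fin r → Fin d → ℂ) × (Fin r → ℂ)) :
    slice id (slicePoint L) = affineSlice L := by
  ext x
  simp [slice, affineSlice, slicePoint]

theorem hasDegree_of_generic {d r n : ℕ} {W : Set (Fin d → ℂ)} (hW : HasDim W r)
    {g : MvPolynomial ((Fin r × Fin d) ⊕ Fin r) ℂ} (hg : g ≠ 0)
    (h : ∀ z, eval z g ≠ 0 → (W ∩ slice id z).encard = n) : HasDegree W n := by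
  refine ⟨r, hW, ?_⟩
  filter_upwards [ae_eval_slicePoint_ne_zero hg] with L hL
  rw [← slice_slicePoint]
  exact h _ hL

/-- Two properties that hold almost everywhere for a nonzero measure hold simultaneously at some
slice. -/
theorem HasDegree.eq_of_generic {d r n δ : ℕ} {W : Set (Fin d → ℂ)} (hW : HasDim W r)
    {g : MvPolynomial ((Fin r × Fin d) ⊕ Fin r) ℂ} (hg : g ≠ 0)
    (h : ∀ z, eval z g ≠ 0 → (W ∩ slice id z).encard = n) (hδ : HasDegree W δ) : δ = n := by
  obtain ⟨r', hr', hae⟩ := hδ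
  obtain rfl := hr'.unique hW
  have hH := isAddHaarMeasure_volume_slices r' d
  obtain ⟨L, h1, h2⟩ := (hae.and (ae_eval_slicePoint_ne_zero hg)).exists
  have h3 := h _ h2
  rw [slice_slicePoint, h1] at h3
  exact_mod_cast h3

/-- The generic count does not change when unused rows are added. -/
theorem generic_count_of_injective {ι κ : Type} {d n : ℕ} (e : ι → κ) (he : Function.Injective e)
    {W : Set (Fin d → ℂ)} {g : MvPolynomial ((ι × Fin d) ⊕ ι) ℂ} (hg : g ≠ 0)
    (h : ∀ z, eval z g ≠ 0 → (W ∩ slice id z).encard = n) :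
    ∃ g' : MvPolynomial ((κ × Fin d) ⊕ ι) ℂ, g' ≠ 0 ∧
      ∀ z, eval z g' ≠ 0 → (W ∩ slice e z).encard = n := by
  let f : (ι × Fin d) ⊕ ι → (κ × Fin d) ⊕ ι := Sum.map (Prod.map e id) id
  have hf : Function.Injective f := (he.prodMap Function.injective_id).sumMap Function.injective_id
  refine ⟨rename f g, ?_, fun z hz => ?_⟩
  · rwa [Ne, map_eq_zero_iff _ (rename_injective _ hf)]
  · rw [eval_rename] at hz
    have hs : slice e z = slice id (z ∘ f) := by
      ext x
      simp [slice, f]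
    rw [hs]
    exact h _ hz

/-! ### The Chow form -/

theorem degreeOf_pderiv_le {σ : Type} (i j : σ) (p : MvPolynomial σ ℂ) :
    degreeOf j (pderiv i p) ≤ degreeOf j p := by
  rw [degreeOf_le_iff]
  intro m hm
  rw [mem_support_iff, coeff_pderiv] at hm
  have h1 : m + Finsupp.single i 1 ∈ p.support := mem_support_iff.mpr (left_ne_zero_of_mul hm)
  have h2 := monomial_le_degreeOf j h1
  rw [Finsupp.add_apply] at h2
  omega

theorem degreeOf_le_of_dvd {σ : Type} (i : σ) {p q : MvPolynomial σ ℂ} (h : p ∣ q) (hq : q ≠ 0) :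
    degreeOf i p ≤ degreeOf i q := by
  obtain ⟨r, rfl⟩ := h
  rw [degreeOf_mul_eq (left_ne_zero_of_mul hq) (right_ne_zero_of_mul hq)]
  omega

/-- Singling out the index `inr none`. -/
def sumOptionEquiv (α ι : Type) : α ⊕ Option ι ≃ Option (α ⊕ ι) where
  toFun := Sum.elim (fun a => some (Sum.inl a)) fun o => o.map Sum.inr
  invFun o := o.elim (Sum.inr none) (Sum.map id some)
  left_inv t := by rcases t with a | (_ | i) <;> rfl
  right_inv t := by rcases t with _ | (a | i) <;> rfl

/-- Reading a polynomial as a univariate polynomial in the variable `inr none`. -/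
noncomputable def splitLast (α ι : Type) :
    MvPolynomial (α ⊕ Option ι) ℂ ≃ₐ[ℂ] Polynomial (MvPolynomial (α ⊕ ι) ℂ) :=
  (renameEquiv ℂ (sumOptionEquiv α ι)).trans (optionEquivLeft ℂ (α ⊕ ι))

theorem splitLast_inl (α ι : Type) (a : α) :
    splitLast α ι (X (Sum.inl a)) = Polynomial.C (X (Sum.inl a)) := by
  simp [splitLast, sumOptionEquiv]

theorem splitLast_inr_none (α ι : Type) :
    splitLast α ι (X (Sum.inr none)) = Polynomial.X := by
  simp [splitLast, sumOptionEquiv]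

theorem splitLast_inr_some (α ι : Type) (i : ι) :
    splitLast α ι (X (Sum.inr (some i))) = Polynomial.C (X (Sum.inr i)) := by
  simp [splitLast, sumOptionEquiv]

theorem splitLast_C (α ι : Type) (r : ℂ) :
    splitLast α ι (C r) = Polynomial.C (C r) := by
  simp [splitLast]

theorem natDegree_splitLast (α ι : Type) (p : MvPolynomial (α ⊕ Option ι) ℂ) :
    (splitLast α ι p).natDegree = degreeOf (Sum.inr none) p := by
  simp only [splitLast, AlgEquiv.trans_apply, renameEquiv_apply, natDegree_optionEquivLeft]
  exact degreeOf_rename_of_injective (sumOptionEquiv α ι).injective (Sum.inr none)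

theorem degreeOf_coeff_splitLast (α ι : Type) (p : MvPolynomial (α ⊕ Option ι) ℂ) (i : ι) (m : ℕ) :
    degreeOf (Sum.inr i) ((splitLast α ι p).coeff m) ≤ degreeOf (Sum.inr (some i)) p := by
  rw [degreeOf_le_iff]
  intro s hs
  simp only [splitLast, AlgEquiv.trans_apply, renameEquiv_apply] at hs
  rw [mem_support_coeff_optionEquivLeft] at hs
  have h1 := monomial_le_degreeOf (some (Sum.inr i)) hs
  have h2 := degreeOf_rename_of_injective (p := p) (sumOptionEquiv α ι).injective
    (Sum.inr (some i))
  have h3 : sumOptionEquiv α ι (Sum.inr (some i)) = some (Sum.inr i) := rfl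
  rw [h3] at h2
  rw [h2] at h1
  simpa using h1

theorem splitLast_pderiv (α ι : Type) (p : MvPolynomial (α ⊕ Option ι) ℂ) :
    splitLast α ι (pderiv (Sum.inr none) p) = Polynomial.derivative (splitLast α ι p) := by
  classical
  induction p using MvPolynomial.induction_on with
  | C r => rw [pderiv_C, splitLast_C, Polynomial.derivative_C, map_zero]
  | add p q hp hq => rw [map_add, map_add, map_add, hp, hq, map_add]
  | mul_X p t hp =>
    have hX : splitLast α ι (pderiv (Sum.inr none) (X t)) =
        Polynomial.derivative (splitLast α ι (X t)) := by
      rcases t with a | (_ | i)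
      · rw [pderiv_X_of_ne (by simp), splitLast_inl, Polynomial.derivative_C, map_zero]
      · rw [pderiv_X_self, splitLast_inr_none, Polynomial.derivative_X, map_one]
      · rw [pderiv_X_of_ne (by simp), splitLast_inr_some, Polynomial.derivative_C, map_zero]
    rw [pderiv_mul, map_add, map_mul, map_mul, map_mul, hp, hX, Polynomial.derivative_mul]

theorem eval₂_splitLast {ι R : Type} {d : ℕ} [CommRing R] [Algebra ℂ R] (x : Fin d → R)
    (G : MvPolynomial ((Option ι × Fin d) ⊕ Option ι) ℂ) :
    (splitLast (Option ι × Fin d) ι G).eval₂ (aeval (R := ℂ) (sliceVec some x)).toRingHom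
      (∑ j, X (none, j) * C (x j)) = aeval (sliceVec id x) G := by
  induction G using MvPolynomial.induction_on with
  | C r => rw [splitLast_C, Polynomial.eval₂_C]; simp
  | add p q hp hq => rw [map_add, Polynomial.eval₂_add, hp, hq, map_add]
  | mul_X p t hp =>
    have hX : (splitLast (Option ι × Fin d) ι (X t)).eval₂
        (aeval (R := ℂ) (sliceVec some x)).toRingHom (∑ j, X (none, j) * C (x j)) =
          aeval (R := ℂ) (sliceVec id x) (X t) := by
      rcases t with a | (_ | i)
      · rw [splitLast_inl, Polynomial.eval₂_C]; simp [sliceVec]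
      · rw [splitLast_inr_none, Polynomial.eval₂_X]; simp [sliceVec]
      · rw [splitLast_inr_some, Polynomial.eval₂_C]; simp [sliceVec]
    rw [map_mul, Polynomial.eval₂_mul, hp, hX, map_mul]

/-- Chain rule: the entry (k, j) of A enters directly and also through the k-th coordinate of Ax,
where its coefficient is x_j. -/
theorem pderiv_aeval_sliceVec {κ R : Type} {d : ℕ} [CommRing R] [Algebra ℂ R]
    (x : Fin d → R) (k : κ) (j : Fin d) (G : MvPolynomial ((κ × Fin d) ⊕ κ) ℂ) :
    pderiv (k, j) (aeval (sliceVec id x) G) =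
      aeval (sliceVec id x) (pderiv (Sum.inl (k, j)) G) +
        C (x j) * aeval (sliceVec id x) (pderiv (Sum.inr k) G) := by
  classical
  induction G using MvPolynomial.induction_on with
  | C r => simp [MvPolynomial.algebraMap_apply]
  | add p q hp hq => simp only [map_add, hp, hq]; ring
  | mul_X p t hp =>
    have hX : pderiv (k, j) (sliceVec id x t) =
        aeval (sliceVec id x) (pderiv (Sum.inl (k, j)) (X t : MvPolynomial _ ℂ)) +
        C (x j) * aeval (sliceVec id x) (pderiv (Sum.inr k) (X t : MvPolynomial _ ℂ)) := by
      rcases t with a | i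
      · by_cases h : a = (k, j)
        · subst h; simp [sliceVec]
        · simp [sliceVec, pderiv_X, h]
      · by_cases h : i = k
        · subst h
          simp [sliceVec, pderiv_X, Pi.single_apply]
        · simp [sliceVec, pderiv_X, h]
    simp only [map_mul, map_add, pderiv_mul, hp, aeval_X, hX]
    ring

theorem aeval_sliceVec_rename {κ R : Type} {d : ℕ} [CommRing R] [Algebra ℂ R]
    (x : Fin d → R) (ρ : κ → κ) (G : MvPolynomial ((κ × Fin d) ⊕ κ) ℂ) :
    aeval (sliceVec id x) (rename (Sum.map (Prod.map ρ id) ρ) G) =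
      rename (Prod.map ρ id) (aeval (sliceVec id x) G) := by
  rw [aeval_rename]
  induction G using MvPolynomial.induction_on with
  | C r => simp [MvPolynomial.algebraMap_apply]
  | add p q hp hq => simp only [map_add, hp, hq]
  | mul_X p t hp =>
    rw [map_mul, hp, map_mul, map_mul, aeval_X, aeval_X]
    congr 1
    rcases t with a | i <;> simp [sliceVec]

/-- The form `F(A, y)` generating all relations between the entries of a generic matrix with
`dim W + 1` rows and the image of a point of `W` under that matrix. -/
theorem exists_chowForm {ι : Type} [Fintype ι] {d n : ℕ} (P : Ideal (MvPolynomial (Fin d) ℂ))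
    [P.IsPrime] (hP : Algebra.trdeg ℂ (MvPolynomial (Fin d) ℂ ⧸ P) = Fintype.card ι)
    {g : MvPolynomial ((ι × Fin d) ⊕ ι) ℂ} (hg : g ≠ 0)
    (hgn : ∀ z, eval z g ≠ 0 → (zeroLocus ℂ P ∩ slice id z).encard = n) :
    ∃ F : MvPolynomial ((Option ι × Fin d) ⊕ Option ι) ℂ, Prime F ∧
      (∀ G, aeval (sliceVec id (coordFun P)) G = 0 ↔ F ∣ G) ∧
      (∀ i, degreeOf (Sum.inr i) F ≤ n) ∧ degreeOf (Sum.inr none) F ≠ 0 ∧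
      aeval (sliceVec id (coordFun P)) (pderiv (Sum.inr none) F) ≠ 0 := by
  classical
  obtain ⟨n', -, ⟨g', hg', hgn'⟩, hrel, -⟩ := exists_slice_data P (some : ι → Option ι)
    (Option.some_injective ι) hP
  obtain ⟨g'', hg'', hgn''⟩ := generic_count_of_injective (some : ι → Option ι)
    (Option.some_injective ι) hg hgn
  -- Two nonzero polynomials have a common point of nonvanishing, and there both counts apply to the
  -- same slice.
  have hnn : n' = n := by
    obtain ⟨z, hz⟩ : ∃ z, eval z (g' * g'') ≠ 0 := by
      by_contra! hcon
      exact mul_ne_zero hg' hg'' (MvPolynomial.funext fun z => by rw [hcon z, map_zero])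
    rw [map_mul] at hz
    have h1 := hgn' z (left_ne_zero_of_mul hz)
    rw [hgn'' z (right_ne_zero_of_mul hz)] at h1
    exact_mod_cast h1.symm
  subst hnn
  obtain ⟨F₀, hF₀p, hF₀pos, hF₀n, hF₀, hF₀dvd⟩ := hrel (∑ j, X (none, j) * C (coordFun P j))
  let Θ := splitLast (Option ι × Fin d) ι
  obtain ⟨F, rfl⟩ := Θ.surjective F₀
  have hFp : Prime F := (MulEquiv.prime_iff Θ.toMulEquiv).mp hF₀p
  have hdvd : ∀ G, aeval (sliceVec id (coordFun P)) G = 0 ↔ F ∣ G := by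
    have hF : aeval (sliceVec id (coordFun P)) F = 0 := by
      rw [← eval₂_splitLast]; exact hF₀
    intro G
    constructor
    · intro hG
      rw [← eval₂_splitLast] at hG
      exact (map_dvd_iff Θ).mp (hF₀dvd _ hG)
    · rintro ⟨H, rfl⟩
      rw [map_mul, hF, zero_mul]
  have hnone : degreeOf (Sum.inr none) F = (Θ F).natDegree := (natDegree_splitLast _ _ F).symm
  refine ⟨F, hFp, hdvd, fun i => ?_, by rw [hnone]; exact hF₀pos.ne', fun hu => ?_⟩
  -- The ideal of relations is invariant under permuting the rows, so F and its image under the swap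
  -- divide each other. The degree bound in the variable of row `none` thus passes to every row.
  · let ρ : Option ι → Option ι := Equiv.swap none i
    have hρ : ∀ o, ρ (ρ o) = o := Equiv.swap_apply_self none i
    let f : (Option ι × Fin d) ⊕ Option ι → (Option ι × Fin d) ⊕ Option ι :=
      Sum.map (Prod.map ρ id) ρ
    have hff : ∀ t, f (f t) = t := by
      rintro (⟨a, j⟩ | a)
      · simp [f, hρ]
      · simp [f, hρ]
    have h1 : F ∣ rename f F := by
      rw [← hdvd, aeval_sliceVec_rename, (hdvd F).mpr dvd_rfl, map_zero]
    have h2 : rename f F ∣ F := by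
      have := map_dvd (rename (R := ℂ) f) h1
      rw [rename_rename] at this
      have hid : f ∘ f = id := funext hff
      rwa [hid, rename_id_apply] at this
    have hfi : Function.Injective f := Function.Involutive.injective hff
    have h3 := degreeOf_rename_of_injective (p := F) hfi (Sum.inr i)
    have h4 : f (Sum.inr i) = Sum.inr none := by simp [f, ρ]
    rw [h4] at h3
    rw [← h3]
    refine (degreeOf_le_of_dvd _ h2 hFp.ne_zero).trans ?_
    rw [hnone]; exact hF₀n
  -- If ∂F/∂y₀ vanished on V it would be divisible by F, yet it is nonzero of smaller degree in y₀.
  · rw [hdvd] at hu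
    have h1 := (map_dvd_iff Θ).mpr hu
    rw [splitLast_pderiv] at h1
    have h2 : Polynomial.derivative (Θ F) ≠ 0 := fun h0 =>
      hF₀pos.ne' (Polynomial.derivative_eq_zero.mp h0)
    have h3 := Polynomial.natDegree_le_of_dvd h1 h2
    have h4 := Polynomial.natDegree_derivative_lt hF₀pos.ne'
    exact absurd h3 (not_le.mpr h4)

/-! ### Submanifolds from holomorphic sections -/

open scoped Topology

/-- A set that is locally the image of a holomorphic section of a linear map is locally a
submanifold. -/
theorem isSmoothPoint_of_section {d k : ℕ} {V : Set (Fin d → ℂ)} {p : Fin d → ℂ} (hp : p ∈ V)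
    (L : (Fin d → ℂ) →L[ℂ] (Fin k → ℂ)) (γ : (Fin k → ℂ) → (Fin d → ℂ)) {U : Set (Fin k → ℂ)}
    (hU : IsOpen U) (hpU : L p ∈ U) (hγ : DifferentiableOn ℂ γ U) (hLγ : ∀ y ∈ U, L (γ y) = y)
    (hV : ∀ᶠ x in 𝓝 p, x ∈ V ↔ x = γ (L x)) : IsSmoothPoint V k p := by
  -- The range of L is a subspace containing the nonempty open set U.
  have hsurj : Function.Surjective L := by
    have h1 : L.toLinearMap.range = ⊤ := by
      apply Submodule.eq_top_of_nonempty_interior' _ ⟨L p, mem_interior.mpr ⟨U, ?_, hU, hpU⟩⟩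
      exact fun y hy => ⟨γ y, hLγ y hy⟩
    exact LinearMap.range_eq_top.mp h1
  have hkd : k ≤ d := by
    have := LinearMap.finrank_le_finrank_of_surjective (f := L.toLinearMap) hsurj
    simpa using this
  let r : (Fin d → ℂ) →L[ℂ] (Fin k → ℂ) :=
    ContinuousLinearMap.pi fun i => ContinuousLinearMap.proj (Fin.castLE hkd i)
  let pad : (Fin k → ℂ) →L[ℂ] (Fin d → ℂ) :=
    ContinuousLinearMap.pi fun i => if h : (i : ℕ) < k then ContinuousLinearMap.proj ⟨i, h⟩ else 0
  have hpadlt : ∀ y (i : Fin d) (h : (i : ℕ) < k), pad y i = y ⟨i, h⟩ := fun y i h => by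
    simp [pad, h]
  have hpadge : ∀ y (i : Fin d), k ≤ (i : ℕ) → pad y i = 0 := fun y i h => by
    simp [pad, not_lt.mpr h]
  have hrpad : ∀ y, r (pad y) = y := fun y => by
    ext i; simp [r, pad]
  -- L and the coordinate projection r have kernels of equal dimension, so a linear change of
  -- coordinates turns L into r.
  obtain ⟨T, hT⟩ : ∃ T : (Fin d → ℂ) ≃L[ℂ] (Fin d → ℂ), ∀ x, r (T x) = L x := by
    obtain ⟨B, hB⟩ := L.toLinearMap.exists_rightInverse_of_surjective (LinearMap.range_eq_top.mpr hsurj)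
    have hB' : ∀ y, L (B y) = y := fun y => LinearMap.congr_fun hB y
    have hrsurj : Function.Surjective r := fun y => ⟨pad y, hrpad y⟩
    have hrank : Module.finrank ℂ L.toLinearMap.ker = Module.finrank ℂ r.toLinearMap.ker := by
      have h1 := L.toLinearMap.finrank_range_add_finrank_ker
      have h2 := r.toLinearMap.finrank_range_add_finrank_ker
      rw [LinearMap.range_eq_top.mpr hsurj] at h1
      rw [LinearMap.range_eq_top.mpr hrsurj] at h2
      omega
    let q := LinearEquiv.ofFinrankEq _ _ hrank
    let c : (Fin d → ℂ) →ₗ[ℂ] L.toLinearMap.ker :=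
      LinearMap.codRestrict _ (LinearMap.id - B ∘ₗ L.toLinearMap) fun x => by
        rw [LinearMap.mem_ker]
        simp [hB']
    let T₀ : (Fin d → ℂ) →ₗ[ℂ] (Fin d → ℂ) :=
      pad.toLinearMap ∘ₗ L.toLinearMap + (Submodule.subtype _) ∘ₗ q.toLinearMap ∘ₗ c
    have hT₀ : ∀ x, r (T₀ x) = L x := by
      intro x
      have h1 : r (q (c x) : Fin d → ℂ) = 0 := (q (c x)).2
      change r (pad (L x) + (q (c x) : Fin d → ℂ)) = L x
      rw [map_add, hrpad, h1, add_zero]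
    have hinj : Function.Injective T₀ := by
      rw [injective_iff_map_eq_zero]
      intro x hx
      have hLx : L x = 0 := by rw [← hT₀, hx, map_zero]
      have h1 : pad (L x) + (q (c x) : Fin d → ℂ) = 0 := hx
      rw [hLx, map_zero, zero_add, ZeroMemClass.coe_eq_zero, q.map_eq_zero_iff] at h1
      have h2 : x - B (L x) = 0 := congrArg Subtype.val h1
      rwa [hLx, map_zero, sub_zero] at h2
    exact ⟨(LinearEquiv.ofInjectiveEndo T₀ hinj).toContinuousLinearEquiv, hT₀⟩
  have hext : ∀ z w : Fin d → ℂ, r z = r w → (∀ i : Fin d, k ≤ (i : ℕ) → z i = w i) → z = w := by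
    intro z w h1 h2
    funext i
    by_cases h : (i : ℕ) < k
    · exact congrFun h1 ⟨i, h⟩
    · exact h2 i (not_lt.mp h)
  have hTL : ∀ z, L (T.symm z) = r z := fun z => by rw [← hT, T.apply_symm_apply]
  -- The chart shears the image of γ flat: its first k coordinates are Lx, and the others measure
  -- the deviation x - γ(Lx), which lies in the kernel of L.
  let f : (Fin d → ℂ) → (Fin d → ℂ) := fun x => T (x - γ (L x)) + pad (L x)
  let f' : (Fin d → ℂ) → (Fin d → ℂ) := fun z => T.symm (z - pad (r z)) + γ (r z)
  have hrf : ∀ x, L x ∈ U → r (f x) = L x := by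
    intro x hx
    simp only [f, map_add, hT, map_sub, hLγ _ hx, sub_self, zero_add, hrpad]
  have hLf' : ∀ z, r z ∈ U → L (f' z) = r z := by
    intro z hz
    simp only [f', map_add, hTL, map_sub, hLγ _ hz, hrpad, sub_self, zero_add]
  have hfd : DifferentiableOn ℂ f (L ⁻¹' U) := by
    have h1 : DifferentiableOn ℂ (fun x => γ (L x)) (L ⁻¹' U) :=
      hγ.comp L.differentiable.differentiableOn fun x hx => hx
    exact (T.differentiable.comp_differentiableOn (differentiableOn_id.sub h1)).add
      (pad.differentiable.comp L.differentiable).differentiableOn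
  have hfd' : DifferentiableOn ℂ f' (r ⁻¹' U) := by
    have h1 : DifferentiableOn ℂ (fun x => γ (r x)) (r ⁻¹' U) :=
      hγ.comp r.differentiable.differentiableOn fun x hx => hx
    exact (T.symm.differentiable.comp_differentiableOn (differentiableOn_id.sub
      (pad.differentiable.comp r.differentiable).differentiableOn)).add h1
  let e : OpenPartialHomeomorph (Fin d → ℂ) (Fin d → ℂ) :=
    { toFun := f
      invFun := f'
      source := L ⁻¹' U
      target := r ⁻¹' U
      map_source' := fun x hx => by
        change r (f x) ∈ U
        rw [hrf x hx]; exact hx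
      map_target' := fun z hz => by
        change L (f' z) ∈ U
        rw [hLf' z hz]; exact hz
      left_inv' := fun x hx => by
        have h1 := hrf x hx
        simp only [f']
        rw [h1]
        simp [f]
      right_inv' := fun z hz => by
        have h1 := hLf' z hz
        simp only [f]
        rw [h1]
        simp [f']
      open_source := hU.preimage L.continuous
      open_target := hU.preimage r.continuous
      continuousOn_toFun := hfd.continuousOn
      continuousOn_invFun := hfd'.continuousOn }
  obtain ⟨O, hOV, hO, hpO⟩ := eventually_nhds_iff.mp hV
  refine ⟨hp, e.restrOpen O hO, ⟨hpU, hpO⟩, hfd.mono fun x hx => hx.1,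
    hfd'.mono fun z hz => hz.1, fun x hx => ?_⟩
  have hxU : L x ∈ U := hx.1
  rw [hOV x hx.2]
  change _ ↔ ∀ i : Fin d, k ≤ (i : ℕ) → f x i = 0
  constructor
  · intro h i hi
    have : f x = pad (L x) := by
      simp only [f]
      rw [← h, sub_self, map_zero, zero_add]
    rw [this, hpadge _ i hi]
  · intro h
    have h1 : f x = pad (L x) :=
      hext _ _ (by rw [hrf x hxU, hrpad]) fun i hi => by rw [h i hi, hpadge _ i hi]
    have h2 : T (x - γ (L x)) = 0 := by simpa [f] using h1
    rw [T.map_eq_zero_iff, sub_eq_zero] at h2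
    exact h2

theorem hasDerivAt_eval_update {σ : Type} [DecidableEq σ] (z : σ → ℂ) (s : σ)
    (p : MvPolynomial σ ℂ) (t : ℂ) :
    HasDerivAt (fun u => eval (Function.update z s u) p)
      (eval (Function.update z s t) (pderiv s p)) t := by
  induction p using MvPolynomial.induction_on with
  | C r => simpa using hasDerivAt_const t r
  | add p q hp hq => simp only [map_add]; exact hp.add hq
  | mul_X p i hp =>
    have hX : HasDerivAt (fun u => Function.update z s u i)
        (eval (Function.update z s t) (pderiv s (X i))) t := by
      by_cases h : i = s
      · subst h; simpa using hasDerivAt_id' t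
      · simpa [h, pderiv_X] using hasDerivAt_const t (z i)
    have := hp.mul hX
    simp only [map_mul, eval_X, pderiv_mul, map_add]
    exact this

/-! ### Recovering points from the Chow form, and smoothness -/

/-- The homogenization of `h` of degree `E`, evaluated at `(q, p₁, …, p_d)`. -/
noncomputable def homSubst {d : ℕ} {S : Type} [CommRing S] [Algebra ℂ S] (E : ℕ)
    (h : MvPolynomial (Fin d) ℂ) (q : S) (p : Fin d → S) : S :=
  ∑ m ∈ h.support, algebraMap ℂ S (coeff m h) * (q ^ (E - ∑ j, m j) * ∏ j, p j ^ m j)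

theorem map_homSubst {d : ℕ} {S S' : Type} [CommRing S] [Algebra ℂ S] [CommRing S'] [Algebra ℂ S']
    (φ : S →ₐ[ℂ] S') (E : ℕ) (h : MvPolynomial (Fin d) ℂ) (q : S) (p : Fin d → S) :
    φ (homSubst E h q p) = homSubst E h (φ q) fun j => φ (p j) := by
  simp [homSubst, map_sum, map_mul, map_prod, map_pow]

/-- The factor `q ^ E` clears the denominators of h at p/q. The degree bound keeps the natural
subtraction in the exponent from truncating. -/
theorem homSubst_eq_mul_aeval {d : ℕ} {S : Type} [CommRing S] [Algebra ℂ S] {E : ℕ}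
    {h : MvPolynomial (Fin d) ℂ} (hE : h.totalDegree ≤ E) {q : S} {p : Fin d → S} {x : Fin d → S}
    (hp : ∀ j, p j = q * x j) : homSubst E h q p = q ^ E * aeval x h := by
  rw [aeval_def, eval₂_eq, Finset.mul_sum, homSubst]
  refine Finset.sum_congr rfl fun m hm => ?_
  have h1 : ∑ j, m j ≤ E := by
    refine le_trans ?_ ((le_totalDegree hm).trans hE)
    rw [Finsupp.sum_fintype _ _ fun _ => rfl]
  have h2 : ∏ j, p j ^ m j = q ^ (∑ j, m j) * ∏ j, x j ^ m j := by
    simp only [hp, mul_pow, Finset.prod_mul_distrib, Finset.prod_pow_eq_pow_sum]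
  have h3 : ∏ j, x j ^ m j = ∏ i ∈ m.support, x i ^ m i := by
    symm
    apply Finset.prod_subset (Finset.subset_univ _)
    intro i _ hi
    rw [Finsupp.notMem_support_iff.mp hi, pow_zero]
  rw [h2, h3, ← pow_sub_mul_pow q h1]
  ring

theorem degreeOf_homSubst_le {d n : ℕ} {σ : Type} (s : σ) {E : ℕ}
    {h : MvPolynomial (Fin d) ℂ} (hE : h.totalDegree ≤ E) {q : MvPolynomial σ ℂ}
    {p : Fin d → MvPolynomial σ ℂ} (hq : degreeOf s q ≤ n) (hp : ∀ j, degreeOf s (p j) ≤ n) :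
    degreeOf s (homSubst E h q p) ≤ E * n := by
  refine (degreeOf_sum_le _ _ _).trans (Finset.sup_le fun m hm => ?_)
  have h1 : ∑ j, m j ≤ E := by
    refine le_trans ?_ ((le_totalDegree hm).trans hE)
    rw [Finsupp.sum_fintype _ _ fun _ => rfl]
  refine (degreeOf_C_mul_le _ _ _).trans ((degreeOf_mul_le _ _ _).trans ?_)
  have h2 : degreeOf s (q ^ (E - ∑ j, m j)) ≤ (E - ∑ j, m j) * n :=
    (degreeOf_pow_le _ _ _).trans (Nat.mul_le_mul_left _ hq)
  have h3 : degreeOf s (∏ j, p j ^ m j) ≤ (∑ j, m j) * n := by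
    refine (degreeOf_prod_le _ _ _).trans ?_
    rw [Finset.sum_mul]
    exact Finset.sum_le_sum fun j _ =>
      (degreeOf_pow_le _ _ _).trans (Nat.mul_le_mul_left _ (hp j))
  calc _ ≤ (E - ∑ j, m j) * n + (∑ j, m j) * n := add_le_add h2 h3
    _ = E * n := by rw [← add_mul, Nat.sub_add_cancel h1]

/-- This is F(A, Ax) = 0 differentiated in the entry (`none`, j). It recovers x_j as a ratio of
partial derivatives of F. -/
theorem aeval_pderiv_chowForm {ι : Type} {d : ℕ} {P : Ideal (MvPolynomial (Fin d) ℂ)}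
    {F : MvPolynomial ((Option ι × Fin d) ⊕ Option ι) ℂ}
    (hF : ∀ G, aeval (sliceVec id (coordFun P)) G = 0 ↔ F ∣ G) (j : Fin d) :
    aeval (sliceVec id (coordFun P)) (-pderiv (Sum.inl (none, j)) F) =
      aeval (sliceVec id (coordFun P)) (pderiv (Sum.inr none) F) * C (coordFun P j) := by
  have h1 := pderiv_aeval_sliceVec (coordFun P) none j F
  rw [(hF F).mpr dvd_rfl, map_zero] at h1
  rw [map_neg, mul_comm]
  linear_combination h1

/-- Substituting the coordinates recovered from the form `F` into a polynomial `h`. -/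
theorem aeval_homSubst_chowForm {ι : Type} {d : ℕ} {P : Ideal (MvPolynomial (Fin d) ℂ)}
    {F : MvPolynomial ((Option ι × Fin d) ⊕ Option ι) ℂ}
    (hF : ∀ G, aeval (sliceVec id (coordFun P)) G = 0 ↔ F ∣ G) {E : ℕ}
    {h : MvPolynomial (Fin d) ℂ} (hE : h.totalDegree ≤ E) :
    aeval (sliceVec id (coordFun P)) (homSubst E h (pderiv (Sum.inr none) F)
      fun j => -pderiv (Sum.inl (none, j)) F) =
      aeval (sliceVec id (coordFun P)) (pderiv (Sum.inr none) F) ^ E *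
        C (Ideal.Quotient.mk P h) := by
  rw [map_homSubst, homSubst_eq_mul_aeval hE (aeval_pderiv_chowForm hF)]
  congr 1
  have h1 : aeval (fun j => C (coordFun P j)) h =
      (IsScalarTower.toAlgHom ℂ (MvPolynomial (Fin d) ℂ ⧸ P)
        (MvPolynomial (Option ι × Fin d) (MvPolynomial (Fin d) ℂ ⧸ P))) (aeval (coordFun P) h) := by
    rw [comp_aeval_apply]; rfl
  rw [h1, aeval_coordFun]
  rfl

theorem eval_chowForm_eq_zero {ι : Type} {d : ℕ} {P : Ideal (MvPolynomial (Fin d) ℂ)}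
    {F : MvPolynomial ((Option ι × Fin d) ⊕ Option ι) ℂ}
    (hF : ∀ G, aeval (sliceVec id (coordFun P)) G = 0 ↔ F ∣ G) {x : Fin d → ℂ}
    (hx : x ∈ zeroLocus ℂ P) (A : Option ι × Fin d → ℂ) :
    eval (Sum.elim A fun i => ∑ j, A (i, j) * x j) F = 0 := by
  have h1 := pointEval_sliceVec P id x hx A F
  rw [(hF F).mpr dvd_rfl, map_zero] at h1
  exact h1.symm

theorem eval_pderiv_chowForm {ι : Type} {d : ℕ} {P : Ideal (MvPolynomial (Fin d) ℂ)}
    {F : MvPolynomial ((Option ι × Fin d) ⊕ Option ι) ℂ}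
    (hF : ∀ G, aeval (sliceVec id (coordFun P)) G = 0 ↔ F ∣ G) {x : Fin d → ℂ}
    (hx : x ∈ zeroLocus ℂ P) (A : Option ι × Fin d → ℂ) (j : Fin d) :
    -eval (Sum.elim A fun i => ∑ j, A (i, j) * x j) (pderiv (Sum.inl (none, j)) F) =
      eval (Sum.elim A fun i => ∑ j, A (i, j) * x j) (pderiv (Sum.inr none) F) * x j := by
  have h1 := congrArg (pointEval P x hx A) (aeval_pderiv_chowForm hF j)
  rw [map_mul, pointEval_sliceVec, pointEval_sliceVec, coordFun, pointEval_C_mk, aeval_X,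
    map_neg] at h1
  exact h1

/-- A zero of the form `F` at which `F` is not critical in the last variable determines a point
of the variety. -/
theorem mem_zeroLocus_of_chowForm {ι : Type} {d : ℕ} {P : Ideal (MvPolynomial (Fin d) ℂ)}
    {F : MvPolynomial ((Option ι × Fin d) ⊕ Option ι) ℂ}
    (hF : ∀ G, aeval (sliceVec id (coordFun P)) G = 0 ↔ F ∣ G)
    {z : (Option ι × Fin d) ⊕ Option ι → ℂ} (h0 : eval z F = 0)
    (hu : eval z (pderiv (Sum.inr none) F) ≠ 0) {x : Fin d → ℂ}
    (hx : ∀ j, x j = -eval z (pderiv (Sum.inl (none, j)) F) / eval z (pderiv (Sum.inr none) F)) :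
    x ∈ zeroLocus ℂ P ∧ x ∈ slice id z := by
  have hker : ∀ G, aeval (sliceVec id (coordFun P)) G = 0 → eval z G = 0 := by
    intro G hG
    obtain ⟨H, rfl⟩ := (hF G).mp hG
    rw [map_mul, h0, zero_mul]
  have hx' : ∀ j, aeval z (-pderiv (Sum.inl (none, j)) F) =
      aeval z (pderiv (Sum.inr none) F) * x j := by
    intro j
    rw [hx, map_neg, aeval_eq_eval]
    exact (mul_div_cancel₀ _ hu).symm
  constructor
  -- Homogenizing p makes it a polynomial in the partial derivatives of F that vanishes on V, hence
  -- a multiple of F, hence zero at z.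
  · intro p hp
    have h1 := aeval_homSubst_chowForm hF (le_refl p.totalDegree)
    rw [Ideal.Quotient.eq_zero_iff_mem.mpr hp, C_0, mul_zero] at h1
    have h2 := hker _ h1
    rw [← aeval_eq_eval, map_homSubst, homSubst_eq_mul_aeval le_rfl hx'] at h2
    exact (mul_eq_zero.mp h2).resolve_left (pow_ne_zero _ hu)
  · intro i
    have h1 : aeval (sliceVec id (coordFun P)) (∑ j, X (Sum.inl (i, j)) *
        -pderiv (Sum.inl (none, j)) F - X (Sum.inr i) * pderiv (Sum.inr none) F) = 0 := by
      rw [map_sub, map_sum, map_mul, sub_eq_zero, aeval_X]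
      simp only [sliceVec, Sum.elim_inr, id, Finset.sum_mul, map_mul, aeval_X, Sum.elim_inl]
      refine Finset.sum_congr rfl fun j _ => ?_
      have := aeval_pderiv_chowForm hF j
      simp only [sliceVec, id] at this
      rw [this]
      ring
    have h2 := hker _ h1
    rw [← aeval_eq_eval, map_sub, map_sum, map_mul, sub_eq_zero, aeval_X] at h2
    simp only [map_mul, aeval_X, hx'] at h2
    have hu' : aeval z (pderiv (Sum.inr none) F) ≠ 0 := hu
    apply mul_right_cancel₀ hu'
    rw [Finset.sum_mul, ← h2]
    exact Finset.sum_congr rfl fun j _ => by simp only [id]; ring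

/-- With A fixed, the implicit function theorem solves F(A, y) = 0 for the coordinate y₀ of row
`none` as a function ψ of the other k. Recovering x from the partial derivatives of F then gives a
holomorphic section γ with values in the variety, and near p every point of the variety is of this
form. -/
theorem isSmoothPoint_of_chowForm {d k : ℕ} {P : Ideal (MvPolynomial (Fin d) ℂ)}
    {F : MvPolynomial ((Option (Fin k) × Fin d) ⊕ Option (Fin k)) ℂ}
    (hF : ∀ G, aeval (sliceVec id (coordFun P)) G = 0 ↔ F ∣ G) {p : Fin d → ℂ}
    (hp : p ∈ zeroLocus ℂ P) {A : Option (Fin k) × Fin d → ℂ}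
    (hu : eval (Sum.elim A fun i => ∑ j, A (i, j) * p j) (pderiv (Sum.inr none) F) ≠ 0) :
    IsSmoothPoint (zeroLocus ℂ P) k p := by
  classical
  let row : Option (Fin k) → (Fin d → ℂ) →L[ℂ] ℂ := fun i =>
    ∑ j, A (i, j) • ContinuousLinearMap.proj j
  have hrow : ∀ i x, row i x = ∑ j, A (i, j) * x j := fun i x => by simp [row]
  let L : (Fin d → ℂ) →L[ℂ] (Fin k → ℂ) := ContinuousLinearMap.pi fun i => row (some i)
  let pt : (Fin k → ℂ) × ℂ → (Option (Fin k) × Fin d) ⊕ Option (Fin k) → ℂ := fun v =>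
    Sum.elim A fun o => o.elim v.2 v.1
  have hpt : ∀ x, pt (L x, row none x) = Sum.elim A fun i => ∑ j, A (i, j) * x j := by
    intro x
    funext t
    rcases t with a | (_ | i) <;> simp [pt, L, hrow]
  have han : ∀ G v, AnalyticAt ℂ (fun v => eval (pt v) G) v := by
    intro G v
    refine AnalyticAt.aeval_mvPolynomial (fun t => ?_) G
    rcases t with a | (_ | i)
    · exact analyticAt_const
    · exact analyticAt_snd
    · exact (ContinuousLinearMap.proj (R := ℂ) (φ := fun _ : Fin k => ℂ) i).analyticAt _ |>.comp
        analyticAt_fst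
  let u₀ : (Fin k → ℂ) × ℂ := (L p, row none p)
  let f : (Fin k → ℂ) × ℂ → ℂ := fun v => eval (pt v) F
  let fu : (Fin k → ℂ) × ℂ → ℂ := fun v => eval (pt v) (pderiv (Sum.inr none) F)
  have hf0 : f u₀ = 0 := by
    simp only [f, u₀, hpt]
    exact eval_chowForm_eq_zero hF hp A
  have hfu0 : fu u₀ ≠ 0 := by simpa only [fu, u₀, hpt] using hu
  have cdf : ContDiffAt ℂ 1 f u₀ := (han F u₀).contDiffAt
  have hder : fderiv ℂ f u₀ (0, 1) = fu u₀ := by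
    have h1 : HasDerivAt (fun t : ℂ => f (u₀.1, t)) (fderiv ℂ f u₀ (0, 1)) u₀.2 := by
      have h2 : HasFDerivAt f (fderiv ℂ f u₀) (u₀.1, u₀.2) :=
        (cdf.differentiableAt one_ne_zero).hasFDerivAt
      exact h2.comp_hasDerivAt u₀.2 ((hasDerivAt_const u₀.2 u₀.1).prodMk (hasDerivAt_id' u₀.2))
    have h3 := hasDerivAt_eval_update (pt u₀) (Sum.inr none) F u₀.2
    have h4 : ∀ t, Function.update (pt u₀) (Sum.inr none) t = pt (u₀.1, t) := by
      intro t
      funext s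
      rcases s with a | (_ | i) <;> simp [pt]
    simp only [h4] at h3
    exact h1.unique h3
  have if₂ : (fderiv ℂ f u₀ ∘L .inr ℂ (Fin k → ℂ) ℂ).IsInvertible := by
    refine ⟨ContinuousLinearEquiv.unitsEquivAut ℂ (Units.mk0 _ hfu0), ?_⟩
    ext
    simp [hder]
  let ψ := cdf.implicitFunction one_ne_zero if₂
  have hψ0 : ψ u₀.1 = u₀.2 := cdf.implicitFunction_apply_self one_ne_zero if₂
  have hψc : ContDiffAt ℂ 1 ψ u₀.1 := cdf.contDiffAt_implicitFunction one_ne_zero if₂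
  let γ : (Fin k → ℂ) → (Fin d → ℂ) := fun y j =>
    -eval (pt (y, ψ y)) (pderiv (Sum.inl (none, j)) F) / fu (y, ψ y)
  have hev : ∀ᶠ y in 𝓝 u₀.1, f (y, ψ y) = 0 ∧ fu (y, ψ y) ≠ 0 ∧ DifferentiableAt ℂ ψ y := by
    have h1 := cdf.eventually_apply_implicitFunction one_ne_zero if₂
    rw [hf0] at h1
    have h2 : ContinuousAt (fun y => fu (y, ψ y)) u₀.1 := by
      refine ContinuousAt.comp (g := fu) (f := fun y => (y, ψ y)) (han _ _).continuousAt
        (continuousAt_id.prodMk hψc.continuousAt)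
    have h3 : ∀ᶠ y in 𝓝 u₀.1, fu (y, ψ y) ≠ 0 := h2.eventually_ne (by
      rw [hψ0]; exact hfu0)
    have h4 := hψc.eventually (by simp)
    filter_upwards [h1, h3, h4] with y a b c
    exact ⟨a, b, c.differentiableAt one_ne_zero⟩
  obtain ⟨U, hUev, hU, hpU⟩ := eventually_nhds_iff.mp hev
  have hγ : ∀ y ∈ U, γ y ∈ zeroLocus ℂ P ∧ γ y ∈ slice id (pt (y, ψ y)) := fun y hy =>
    mem_zeroLocus_of_chowForm hF (hUev y hy).1 (hUev y hy).2.1 fun j => rfl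
  refine isSmoothPoint_of_section hp L γ hU hpU ?_ ?_ ?_
  · intro y hy
    obtain ⟨-, h1, h2⟩ := hUev y hy
    have h3 : ∀ G, DifferentiableAt ℂ (fun y => eval (pt (y, ψ y)) G) y := fun G =>
      DifferentiableAt.comp (g := fun v => eval (pt v) G) (f := fun y => (y, ψ y)) y
        (han G _).differentiableAt (differentiableAt_id.prodMk h2)
    have h4 : ∀ j, DifferentiableAt ℂ (fun y => γ y j) y := fun j => by
      simp only [γ, div_eq_mul_inv]
      exact (h3 (pderiv (Sum.inl (none, j)) F)).neg.mul
        ((h3 (pderiv (Sum.inr none) F)).inv h1)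
    exact (differentiableAt_pi.mpr h4).differentiableWithinAt
  · intro y hy
    funext i
    have := (hγ y hy).2 (some i)
    simpa [L, hrow, pt] using this
  · have hcont : ContinuousAt (fun x => (L x, row none x)) p :=
      (L.continuous.prodMk (row none).continuous).continuousAt
    have h1 : ∀ᶠ x in 𝓝 p, f (L x, row none x) = f u₀ ↔ ψ (L x) = row none x :=
      hcont.eventually (cdf.eventually_apply_eq_iff_implicitFunction one_ne_zero if₂)
    have h2 : ∀ᶠ x in 𝓝 p, L x ∈ U := L.continuous.continuousAt.eventually (hU.mem_nhds hpU)
    filter_upwards [h1, h2] with x hx1 hx2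
    constructor
    · intro hx
      have h3 : f (L x, row none x) = f u₀ := by
        rw [hf0]
        simp only [f, hpt]
        exact eval_chowForm_eq_zero hF hx A
      have h4 := hx1.mp h3
      funext j
      have h5 := eval_pderiv_chowForm hF hx A j
      rw [← hpt, ← h4] at h5
      exact (eq_div_iff (hUev _ hx2).2.1).mpr (by rw [mul_comm]; exact h5.symm)
    · intro hx
      rw [hx]
      exact (hγ _ hx2).1

/-! ### Resultants and a Bézout bound -/

/-- By Gauss's lemma f stays irreducible over the fraction field. It also still fails to divide h
there, so the two are coprime. -/
theorem resultant_ne_zero_of_prime {B : Type} [CommRing B] [IsDomain B]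
    [UniqueFactorizationMonoid B] {f h : Polynomial B} (hf : Prime f) (hf0 : f.natDegree ≠ 0)
    (hfh : ¬ f ∣ h) : f.resultant h ≠ 0 := by
  classical
  let K := FractionRing B
  let : NormalizedGCDMonoid B := Classical.choice inferInstance
  have hinj : Function.Injective (algebraMap B K) := IsFractionRing.injective B K
  have hirr : Irreducible (f.map (algebraMap B K)) :=
    ((hf.irreducible.isPrimitive hf0).irreducible_iff_irreducible_map_fraction_map).mp
      hf.irreducible
  have hcop : IsCoprime (f.map (algebraMap B K)) (h.map (algebraMap B K)) := by
    refine (hirr.isCoprime_or_dvd _).resolve_right ?_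
    rintro ⟨q, hq⟩
    obtain ⟨⟨b, hb⟩, hbq⟩ := IsLocalization.exist_integer_multiples_of_finset
      (nonZeroDivisors B) q.coeffs
    obtain ⟨G, hG⟩ := exists_map_eq_C_mul hbq
    have heq : Polynomial.C b * h = f * G := by
      refine Polynomial.map_injective _ hinj ?_
      rw [Polynomial.map_mul, Polynomial.map_mul, Polynomial.map_C, hq, hG]
      ring
    refine (hf.dvd_or_dvd (heq ▸ dvd_mul_right f G)).elim (fun h1 => ?_) hfh
    have := Polynomial.natDegree_le_of_dvd h1
      (Polynomial.C_ne_zero.mpr (nonZeroDivisors.ne_zero hb))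
    rw [Polynomial.natDegree_C] at this
    omega
  intro h0
  have h1 := Polynomial.resultant_ne_zero _ _ hcop
  rw [Polynomial.natDegree_map_eq_of_injective hinj, Polynomial.natDegree_map_eq_of_injective hinj,
    Polynomial.resultant_map_map, h0, map_zero] at h1
  exact h1 rfl

theorem degreeOf_det_le {σ n : Type} [Fintype n] [DecidableEq n] (s : σ)
    (M : Matrix n n (MvPolynomial σ ℂ)) {b : ℕ} (hM : ∀ i j, degreeOf s (M i j) ≤ b) :
    degreeOf s M.det ≤ Fintype.card n * b := by
  rw [Matrix.det_apply]
  refine (degreeOf_sum_le _ _ _).trans (Finset.sup_le fun π _ => ?_)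
  have h1 : degreeOf s (∏ i, M (π i) i) ≤ Fintype.card n * b := by
    refine (degreeOf_prod_le _ _ _).trans ((Finset.sum_le_sum fun i _ => hM (π i) i).trans ?_)
    simp
  rcases Int.units_eq_one_or (Equiv.Perm.sign π) with h | h <;> rw [h]
  · simpa using h1
  · have h2 : (-1 : ℤˣ) • ∏ i, M (π i) i = C (-1) * ∏ i, M (π i) i := by
      simp [Units.smul_def]
    rw [h2]
    exact (degreeOf_C_mul_le _ _ _).trans h1

theorem degreeOf_resultant_le {σ : Type} (s : σ) (f g : Polynomial (MvPolynomial σ ℂ)) {b : ℕ}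
    (hf : ∀ m, degreeOf s (f.coeff m) ≤ b) (hg : ∀ m, degreeOf s (g.coeff m) ≤ b) :
    degreeOf s (f.resultant g) ≤ (f.natDegree + g.natDegree) * b := by
  refine (degreeOf_det_le s (f.sylvester g f.natDegree g.natDegree) (b := b) fun i j => ?_).trans
    (by simp)
  induction j using Fin.addCases with
  | left j =>
    simp only [Polynomial.sylvester, Matrix.of_apply, Fin.addCases_left]
    split_ifs
    · exact hg _
    · simp
  | right j =>
    simp only [Polynomial.sylvester, Matrix.of_apply, Fin.addCases_right]
    split_ifs
    · exact hf _
    · simp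

theorem eval₂_eval_splitLast {α ι : Type} (z : α ⊕ Option ι → ℂ)
    (G : MvPolynomial (α ⊕ Option ι) ℂ) :
    (splitLast α ι G).eval₂ (eval (z ∘ Sum.map id some)) (z (Sum.inr none)) = eval z G := by
  induction G using MvPolynomial.induction_on with
  | C r => rw [splitLast_C, Polynomial.eval₂_C, eval_C, eval_C]
  | add p q hp hq => rw [map_add, Polynomial.eval₂_add, hp, hq, map_add]
  | mul_X p t hp =>
    have hX : (splitLast α ι (X t)).eval₂ (eval (z ∘ Sum.map id some)) (z (Sum.inr none)) =
        eval z (X t) := by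
      rcases t with a | (_ | i)
      · rw [splitLast_inl, Polynomial.eval₂_C]; simp
      · rw [splitLast_inr_none, Polynomial.eval₂_X]; simp
      · rw [splitLast_inr_some, Polynomial.eval₂_C]; simp
    rw [map_mul, Polynomial.eval₂_mul, hp, hX, map_mul]

theorem exists_eval_ne_zero {σ : Type} {p : MvPolynomial σ ℂ} (hp : p ≠ 0) :
    ∃ z, eval z p ≠ 0 := by
  by_contra! hcon
  exact hp (MvPolynomial.funext fun z => by rw [hcon z, map_zero])

/-- The generic count does not depend on the indexing of the rows. -/
theorem generic_count_equiv {ι ι' : Type} {d n : ℕ} (e : ι ≃ ι')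
    {W : Set (Fin d → ℂ)} {g : MvPolynomial ((ι × Fin d) ⊕ ι) ℂ} (hg : g ≠ 0)
    (h : ∀ z, eval z g ≠ 0 → (W ∩ slice id z).encard = n) :
    ∃ g' : MvPolynomial ((ι' × Fin d) ⊕ ι') ℂ, g' ≠ 0 ∧
      ∀ z, eval z g' ≠ 0 → (W ∩ slice id z).encard = n := by
  let f : (ι × Fin d) ⊕ ι → (ι' × Fin d) ⊕ ι' := Sum.map (Prod.map e id) e
  have hf : Function.Injective f :=
    (e.injective.prodMap Function.injective_id).sumMap e.injective
  refine ⟨rename f g, ?_, fun z hz => ?_⟩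
  · rwa [Ne, map_eq_zero_iff _ (rename_injective _ hf)]
  · rw [eval_rename] at hz
    have hs : slice id z = slice id (z ∘ f) := by
      ext x
      simp only [slice, f, Set.mem_ofPred_eq, Function.comp, Sum.map_inl, Sum.map_inr, Prod.map, id]
      exact ⟨fun h i => h (e i), fun h i => by simpa using h (e.symm i)⟩
    rw [hs]
    exact h _ hz

/-- A generic slice of a variety of complementary dimension avoids a given hypersurface not
containing the variety. -/
theorem exists_slice_avoids {ι κ : Type} [Fintype ι] [Fintype κ] {d : ℕ}
    (Q : Ideal (MvPolynomial (Fin d) ℂ)) [Q.IsPrime] (e : ι → κ) (he : Function.Injective e)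
    (hQ : Algebra.trdeg ℂ (MvPolynomial (Fin d) ℂ ⧸ Q) = Fintype.card ι)
    {t : MvPolynomial (Fin d) ℂ} (ht : t ∉ Q) :
    ∃ b : MvPolynomial ((κ × Fin d) ⊕ ι) ℂ, b ≠ 0 ∧
      ∀ z, eval z b ≠ 0 → ∀ x ∈ zeroLocus ℂ Q ∩ slice e z, aeval x t ≠ 0 := by
  obtain ⟨n, -, -, -, h⟩ := exists_slice_data Q e he hQ
  obtain ⟨b, hb, c, hc⟩ := h (C (Ideal.Quotient.mk Q t)) (by
    rwa [Ne, C_eq_zero, Ideal.Quotient.eq_zero_iff_mem])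
  refine ⟨b, hb, fun z hz x hx h0 => hz ?_⟩
  have h1 := pointEval_sliceVec Q e x hx.1 (fun a => z (Sum.inl a)) b
  rw [hc, map_mul, pointEval_C_mk, h0, zero_mul] at h1
  rw [h1]
  congr 2
  funext s
  rcases s with a | i
  · rfl
  · exact (hx.2 i).symm

/-- Replacing one row of the matrix part of a point by a row that keeps a polynomial nonzero and
separates finitely many points. -/
theorem exists_separating_row {κ ι : Type} [DecidableEq κ] {d : ℕ} (r : κ)
    {p : MvPolynomial ((κ × Fin d) ⊕ ι) ℂ} {z : (κ × Fin d) ⊕ ι → ℂ} (hz : eval z p ≠ 0)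
    {S : Set (Fin d → ℂ)} (hS : S.Finite) :
    ∃ z' : (κ × Fin d) ⊕ ι → ℂ, eval z' p ≠ 0 ∧ (∀ i, z' (Sum.inr i) = z (Sum.inr i)) ∧
      (∀ a : κ × Fin d, a.1 ≠ r → z' (Sum.inl a) = z (Sum.inl a)) ∧
      Set.InjOn (fun x => ∑ j, z' (Sum.inl (r, j)) * x j) S := by
  classical
  let sub : (κ × Fin d) ⊕ ι → MvPolynomial (Fin d) ℂ :=
    Sum.elim (fun a => if a.1 = r then X a.2 else C (z (Sum.inl a))) fun i => C (z (Sum.inr i))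
  let z' : (Fin d → ℂ) → (κ × Fin d) ⊕ ι → ℂ := fun w t => eval w (sub t)
  have hev : ∀ w, eval w (aeval sub p) = eval (z' w) p := by
    intro w
    rw [← aeval_eq_eval, ← aeval_eq_eval]
    rw [comp_aeval_apply]
    rfl
  let sep : (Fin d → ℂ) × (Fin d → ℂ) → MvPolynomial (Fin d) ℂ := fun q =>
    ∑ j, X j * C (q.1 j - q.2 j)
  let T : Finset ((Fin d → ℂ) × (Fin d → ℂ)) :=
    (hS.toFinset ×ˢ hS.toFinset).filter fun q => q.1 ≠ q.2
  have hp0 : aeval sub p ≠ 0 := by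
    intro h0
    have h1 := hev fun j => z (Sum.inl (r, j))
    rw [h0, map_zero] at h1
    apply hz
    rw [h1]
    congr 2
    funext t
    rcases t with ⟨a, j⟩ | i
    · by_cases h : a = r
      · subst h; simp [z', sub]
      · simp [z', sub, h]
    · simp [z', sub]
  have hsep0 : ∏ q ∈ T, sep q ≠ 0 := by
    rw [Finset.prod_ne_zero_iff]
    intro q hq h0
    refine (Finset.mem_filter.mp hq).2 (funext fun j => ?_)
    have h1 := congrArg (eval (Pi.single j (1 : ℂ))) h0
    simpa [sep, Pi.single_apply, sub_eq_zero] using h1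
  obtain ⟨w, hw⟩ := exists_eval_ne_zero (mul_ne_zero hp0 hsep0)
  rw [map_mul] at hw
  refine ⟨z' w, ?_, fun i => by simp [z', sub], fun a ha => by simp [z', sub, ha], ?_⟩
  · rw [← hev]; exact left_ne_zero_of_mul hw
  · intro x hx y hy hxy
    by_contra hne
    have h1 : (x, y) ∈ T := by simp [T, hx, hy, hne]
    have h2 := right_ne_zero_of_mul hw
    rw [map_prod, Finset.prod_ne_zero_iff] at h2
    apply h2 _ h1
    simp only [z', sub, Sum.elim_inl, if_true, eval_X] at hxy
    simp only [sep, map_sum, map_mul, eval_X, eval_C, mul_sub, Finset.sum_sub_distrib]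
    rw [hxy, sub_self]

/-- A bound for the total degree of distinct components of codimension one of a hypersurface
section of a variety. -/
theorem sum_degree_le_of_hypersurface_section {ι τ : Type} [Fintype ι] {d n E : ℕ}
    (P : Ideal (MvPolynomial (Fin d) ℂ)) [P.IsPrime]
    (hP : Algebra.trdeg ℂ (MvPolynomial (Fin d) ℂ ⧸ P) = Fintype.card (Option ι))
    {g : MvPolynomial ((Option ι × Fin d) ⊕ Option ι) ℂ} (hg : g ≠ 0)
    (hgn : ∀ z, eval z g ≠ 0 → (zeroLocus ℂ P ∩ slice id z).encard = n)
    {h : MvPolynomial (Fin d) ℂ} (hh : h ∉ P) (hE : h.totalDegree ≤ E)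
    (s : Finset τ) (Q : τ → Ideal (MvPolynomial (Fin d) ℂ)) (hQp : ∀ i ∈ s, (Q i).IsPrime)
    (hPQ : ∀ i ∈ s, P ≤ Q i) (hhQ : ∀ i ∈ s, h ∈ Q i) (hQinj : Set.InjOn Q s)
    (hQ : ∀ i ∈ s, Algebra.trdeg ℂ (MvPolynomial (Fin d) ℂ ⧸ Q i) = Fintype.card ι)
    (c : τ → ℕ) (hc : ∀ i ∈ s, ∃ g : MvPolynomial ((ι × Fin d) ⊕ ι) ℂ, g ≠ 0 ∧
      ∀ z, eval z g ≠ 0 → (zeroLocus ℂ (Q i) ∩ slice id z).encard = c i) :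
    ∑ i ∈ s, c i ≤ (n + E * n) * (n + E * n) := by
  classical
  -- There are card ι + 2 rows, one more than the dimension of the large variety. The rows in the
  -- range of e slice the components, row `some none` separates points, and row `none` is eliminated
  -- by the resultant.
  let κ := Option (Option ι)
  let e : ι → κ := fun i => some (some i)
  have he : Function.Injective e := fun i j hij =>
    Option.some_injective _ (Option.some_injective _ hij)
  obtain ⟨F, hFp, hF, hFn, hF0, hFu⟩ := exists_chowForm P hP hg hgn
  let H := homSubst E h (pderiv (Sum.inr none) F) fun j => -pderiv (Sum.inl (none, j)) F
  have hHn : ∀ i, degreeOf (Sum.inr i) H ≤ E * n := fun i =>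
    degreeOf_homSubst_le _ hE ((degreeOf_pderiv_le _ _ _).trans (hFn i)) fun j => by
      rw [degreeOf_neg]
      exact (degreeOf_pderiv_le _ _ _).trans (hFn i)
  have hFH : ¬ F ∣ H := by
    rw [← hF, aeval_homSubst_chowForm hF hE]
    refine mul_ne_zero (pow_ne_zero _ hFu) ?_
    rwa [Ne, C_eq_zero, Ideal.Quotient.eq_zero_iff_mem]
  let Θ := splitLast (κ × Fin d) (Option ι)
  let N := (Θ F).resultant (Θ H)
  have hΘF0 : (Θ F).natDegree ≠ 0 := by rwa [natDegree_splitLast]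
  have hN0 : N ≠ 0 := resultant_ne_zero_of_prime
    ((MulEquiv.prime_iff Θ.toMulEquiv).mpr hFp) hΘF0 fun hd => hFH ((map_dvd_iff Θ).mp hd)
  -- One factor bounds the size of the Sylvester matrix, the other the degrees of its entries.
  have hNdeg : degreeOf (Sum.inr none) N ≤ (n + E * n) * (n + E * n) := by
    refine (degreeOf_resultant_le _ _ _ (b := n + E * n) (fun m => ?_) fun m => ?_).trans
      (Nat.mul_le_mul_right _ (add_le_add ?_ ?_))
    · exact ((degreeOf_coeff_splitLast _ _ _ _ _).trans (hFn _)).trans (Nat.le_add_right _ _)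
    · exact ((degreeOf_coeff_splitLast _ _ _ _ _).trans (hHn _)).trans (Nat.le_add_left _ _)
    · rw [natDegree_splitLast]; exact hFn _
    · rw [natDegree_splitLast]; exact hHn _
  obtain ⟨a, b, -, -, hab⟩ := Polynomial.exists_mul_add_mul_eq_C_resultant (Θ F) (Θ H)
    le_rfl le_rfl (Or.inl hΘF0)
  -- The resultant is a combination of F and H, and both vanish at (A, Ax) when h(x) = 0.
  have hNroot : ∀ x ∈ zeroLocus ℂ P, aeval x h = 0 → ∀ A : κ × Fin d → ℂ,
      eval ((Sum.elim A fun i : κ => ∑ j, A (i, j) * x j) ∘ Sum.map id some) N = 0 := by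
    intro x hx hhx A
    set Z : (κ × Fin d) ⊕ κ → ℂ := Sum.elim A fun i => ∑ j, A (i, j) * x j with hZ
    have hF0 : eval Z F = 0 := eval_chowForm_eq_zero hF hx A
    have hH0 : eval Z H = 0 := by
      have h1 := congrArg (pointEval P x hx A) (aeval_homSubst_chowForm hF hE)
      rw [pointEval_sliceVec, map_mul, pointEval_C_mk, hhx, mul_zero] at h1
      exact h1
    have h2 := congrArg (Polynomial.eval₂ (eval (Z ∘ Sum.map id some)) (Z (Sum.inr none))) hab
    rw [Polynomial.eval₂_add, Polynomial.eval₂_mul, Polynomial.eval₂_mul, Polynomial.eval₂_C,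
      eval₂_eval_splitLast, eval₂_eval_splitLast, hF0, hH0, zero_mul, zero_mul, add_zero] at h2
    exact h2.symm
  let M := splitLast (κ × Fin d) ι N
  have hM0 : M ≠ 0 := by
    rwa [Ne, EmbeddingLike.map_eq_zero_iff]
  -- a slice of complementary dimension that is generic for all components
  choose! g₁ hg₁ hgc₁ using hc
  have hg₂ : ∀ i ∈ s, ∃ g' : MvPolynomial ((κ × Fin d) ⊕ ι) ℂ, g' ≠ 0 ∧
      ∀ z, eval z g' ≠ 0 → (zeroLocus ℂ (Q i) ∩ slice e z).encard = c i := fun i hi =>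
    generic_count_of_injective e he (hg₁ i hi) (hgc₁ i hi)
  choose! g₂ hg₂ hgc₂ using hg₂
  -- Distinct components of equal dimension are not nested, so a generic slice of one misses the
  -- other and no point is counted twice.
  have hdisj : ∀ q ∈ s.offDiag, ∃ b : MvPolynomial ((κ × Fin d) ⊕ ι) ℂ, b ≠ 0 ∧
      ∀ z, eval z b ≠ 0 → ∀ x ∈ zeroLocus ℂ (Q q.1) ∩ slice e z, x ∉ zeroLocus ℂ (Q q.2) := by
    intro q hq
    obtain ⟨h1, h2, h3⟩ := Finset.mem_offDiag.mp hq
    have := hQp _ h1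
    have := hQp _ h2
    have hle : ¬ Q q.2 ≤ Q q.1 := by
      intro hle
      have hlt := trdeg_quotient_lt_of_lt (k := ℂ)
        (lt_of_le_of_ne hle fun heq => h3 (hQinj h1 h2 heq.symm))
      rw [hQ _ h1, hQ _ h2] at hlt
      exact lt_irrefl _ hlt
    obtain ⟨t, ht2, ht1⟩ := Set.not_subset.mp hle
    obtain ⟨b, hb, hbx⟩ := exists_slice_avoids (Q q.1) e he (hQ _ h1) ht1
    exact ⟨b, hb, fun z hz x hx hx2 => hbx z hz x hx (hx2 t ht2)⟩
  choose! b₁ hb₁ hbx₁ using hdisj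
  obtain ⟨z₀, hz₀⟩ := exists_eval_ne_zero (mul_ne_zero (mul_ne_zero
    (Finset.prod_ne_zero_iff.mpr hg₂) (Finset.prod_ne_zero_iff.mpr hb₁))
    (Polynomial.leadingCoeff_ne_zero.mpr hM0))
  rw [map_mul, map_mul, map_prod, map_prod] at hz₀
  have hzg := Finset.prod_ne_zero_iff.mp (left_ne_zero_of_mul (left_ne_zero_of_mul hz₀))
  have hzb := Finset.prod_ne_zero_iff.mp (right_ne_zero_of_mul (left_ne_zero_of_mul hz₀))
  have hcard : ∀ i ∈ s, (zeroLocus ℂ (Q i) ∩ slice e z₀).encard = c i := fun i hi =>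
    hgc₂ i hi z₀ (hzg i hi)
  have hfin : ∀ i ∈ s, (zeroLocus ℂ (Q i) ∩ slice e z₀).Finite := fun i hi =>
    Set.finite_of_encard_eq_coe (hcard i hi)
  choose! S hS using fun i (hi : i ∈ s) => (hfin i hi).exists_finset_coe
  let S' : Finset (Fin d → ℂ) := s.biUnion S
  have hS' : S'.card = ∑ i ∈ s, c i := by
    rw [Finset.card_biUnion]
    · refine Finset.sum_congr rfl fun i hi => ?_
      have h1 := hcard i hi
      rw [← hS i hi, Set.encard_coe_eq_coe_finsetCard] at h1
      exact_mod_cast h1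
    · intro i hi j hj hij
      refine Finset.disjoint_left.mpr ?_
      intro x hxi hxj
      rw [← Finset.mem_coe, hS i hi] at hxi
      rw [← Finset.mem_coe, hS j hj] at hxj
      have hq : (i, j) ∈ s.offDiag := Finset.mem_offDiag.mpr ⟨hi, hj, hij⟩
      exact hbx₁ (i, j) hq z₀ (hzb _ hq) x hxi hxj.1
  -- Only row `some none` changes, so the slice and its points stay fixed. The leading coefficient
  -- of M must stay nonzero so that `Mz` is not the zero polynomial.
  obtain ⟨z, hz, hzr, hzl, hzS⟩ := exists_separating_row (some none : κ)
    (right_ne_zero_of_mul hz₀) S'.finite_toSet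
  let Mz := M.map (eval z)
  have hMz : Mz ≠ 0 := fun h0 => hz (by
    have h1 := congrArg (fun p => p.coeff M.natDegree) h0
    simpa [Mz] using h1)
  have hroot : ∀ x ∈ S', (∑ j, z (Sum.inl (some none, j)) * x j) ∈ Mz.roots := by
    intro x hx
    obtain ⟨i, hi, hxi⟩ := Finset.mem_biUnion.mp hx
    rw [← Finset.mem_coe, hS i hi] at hxi
    rw [Polynomial.mem_roots hMz, Polynomial.IsRoot, Polynomial.eval_map]
    have h1 := hNroot x (fun p hp => hxi.1 p (hPQ i hi hp)) (hxi.1 h (hhQ i hi))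
      fun a => z (Sum.inl a)
    rw [← eval₂_eval_splitLast] at h1
    refine Eq.trans ?_ h1
    congr 2
    funext t
    rcases t with a | k
    · rfl
    · have h2 : ∑ j, z₀ (Sum.inl (e k, j)) * x j = z₀ (Sum.inr k) := hxi.2 k
      change z (Sum.inr k) = ∑ j, z (Sum.inl (e k, j)) * x j
      rw [hzr, ← h2]
      refine Finset.sum_congr rfl fun j _ => ?_
      rw [hzl (e k, j) (by simp [e])]
  calc ∑ i ∈ s, c i = S'.card := hS'.symm
    _ = (S'.image fun x => ∑ j, z (Sum.inl (some none, j)) * x j).card :=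
      (Finset.card_image_of_injOn hzS).symm
    _ ≤ Mz.roots.toFinset.card := Finset.card_le_card fun y hy => by
      obtain ⟨x, hx, rfl⟩ := Finset.mem_image.mp hy
      exact Multiset.mem_toFinset.mpr (hroot x hx)
    _ ≤ Multiset.card Mz.roots := Multiset.toFinset_card_le _
    _ ≤ Mz.natDegree := Polynomial.card_roots' _
    _ ≤ M.natDegree := Polynomial.natDegree_map_le
    _ = degreeOf (Sum.inr none) N := natDegree_splitLast _ _ _
    _ ≤ _ := hNdeg

/-! ### The hypersurface containing the singular points, and the conclusion -/

theorem exists_pointEval_ne_zero {κ : Type} {d : ℕ} (P : Ideal (MvPolynomial (Fin d) ℂ))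
    [P.IsPrime] {t : MvPolynomial (κ × Fin d) (MvPolynomial (Fin d) ℂ ⧸ P)} (ht : t ≠ 0) :
    ∃ x, ∃ hx : x ∈ zeroLocus ℂ P, ∃ A, pointEval P x hx A t ≠ 0 := by
  obtain ⟨m, hm⟩ := ne_zero_iff.mp ht
  obtain ⟨q, hq⟩ := Ideal.Quotient.mk_surjective (coeff m t)
  have hqP : q ∉ P := fun h => hm (by rw [← hq, Ideal.Quotient.eq_zero_iff_mem.mpr h])
  obtain ⟨x, hx, hqx⟩ : ∃ x ∈ zeroLocus ℂ P, aeval x q ≠ 0 := by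
    by_contra! hcon
    apply hqP
    rw [← IsPrime.vanishingIdeal_zeroLocus (K := ℂ) P]
    exact hcon
  have h0 : map (Ideal.Quotient.lift P (aeval (R := ℂ) x).toRingHom hx) t ≠ 0 := by
    refine ne_zero_iff.mpr ⟨m, ?_⟩
    rw [coeff_map, ← hq]
    exact hqx
  obtain ⟨A, hA⟩ := exists_eval_ne_zero h0
  rw [eval_map] at hA
  exact ⟨x, hx, A, hA⟩

/-- Substituting the coordinates of `A x` into a polynomial. -/
noncomputable def rowSubst {κ : Type} {d : ℕ} (A : κ × Fin d → ℂ)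
    (G : MvPolynomial ((κ × Fin d) ⊕ κ) ℂ) : MvPolynomial (Fin d) ℂ :=
  aeval (Sum.elim (fun a => C (A a)) fun i => ∑ j, C (A (i, j)) * X j) G

theorem aeval_rowSubst {κ : Type} {d : ℕ} (A : κ × Fin d → ℂ)
    (G : MvPolynomial ((κ × Fin d) ⊕ κ) ℂ) (x : Fin d → ℂ) :
    aeval x (rowSubst A G) = eval (Sum.elim A fun i => ∑ j, A (i, j) * x j) G := by
  rw [rowSubst, comp_aeval_apply, ← aeval_eq_eval]
  congr 2
  funext t
  rcases t with a | i <;> simp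

theorem totalDegree_rowSubst_le {κ : Type} [Fintype κ] {d n : ℕ} (A : κ × Fin d → ℂ)
    {G : MvPolynomial ((κ × Fin d) ⊕ κ) ℂ} (hG : ∀ i, degreeOf (Sum.inr i) G ≤ n) :
    (rowSubst A G).totalDegree ≤ Fintype.card κ * n := by
  rw [rowSubst, aeval_def, eval₂_eq']
  refine totalDegree_finsetSum_le fun m hm => ?_
  refine (totalDegree_mul _ _).trans ?_
  rw [MvPolynomial.algebraMap_eq, totalDegree_C, zero_add]
  refine (totalDegree_finsetProd _ _).trans ?_
  rw [Fintype.sum_sum_type]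
  have h1 : ∀ a : κ × Fin d, (C (A a) ^ m (Sum.inl a) : MvPolynomial (Fin d) ℂ).totalDegree = 0 :=
    fun a => by rw [← map_pow, totalDegree_C]
  have h2 : ∀ i, ((∑ j, C (A (i, j)) * X j) ^ m (Sum.inr i) :
      MvPolynomial (Fin d) ℂ).totalDegree ≤ n := by
    intro i
    refine (totalDegree_pow _ _).trans ?_
    have h3 : (∑ j, C (A (i, j)) * X j : MvPolynomial (Fin d) ℂ).totalDegree ≤ 1 :=
      totalDegree_finsetSum_le fun j _ => (totalDegree_mul _ _).trans (by
        rw [totalDegree_C, totalDegree_X])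
    calc _ ≤ m (Sum.inr i) * 1 := Nat.mul_le_mul_left _ h3
      _ ≤ n := by rw [mul_one]; exact (monomial_le_degreeOf _ hm).trans (hG i)
  simp only [Sum.elim_inl, Sum.elim_inr, h1, Finset.sum_const_zero, zero_add]
  refine (Finset.sum_le_sum fun i _ => h2 i).trans ?_
  simp

theorem trdeg_quotient_le {d k : ℕ} {P : Ideal (MvPolynomial (Fin d) ℂ)}
    (h : Algebra.trdeg ℂ (MvPolynomial (Fin d) ℂ ⧸ P) = k) : k ≤ d := by
  have h1 := trdeg_le_of_surjective (Ideal.Quotient.mkₐ ℂ P)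
    (Ideal.Quotient.mkₐ_surjective ℂ P)
  rw [h, MvPolynomial.trdeg_of_isDomain] at h1
  simpa using h1

/-- The components of a hypersurface section of a variety have codimension one, and their number
and degrees are bounded. -/
theorem exists_degrees_minimalPrimes {d n E k : ℕ} (P : Ideal (MvPolynomial (Fin d) ℂ)) [P.IsPrime]
    (hP : Algebra.trdeg ℂ (MvPolynomial (Fin d) ℂ ⧸ P) = k)
    {g : MvPolynomial ((Fin k × Fin d) ⊕ Fin k) ℂ} (hg : g ≠ 0)
    (hgn : ∀ z, eval z g ≠ 0 → (zeroLocus ℂ P ∩ slice id z).encard = n)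
    {h : MvPolynomial (Fin d) ℂ} (hh : h ∉ P) (hE : h.totalDegree ≤ E)
    {s : Finset (Ideal (MvPolynomial (Fin d) ℂ))}
    (hs : ∀ Q ∈ s, Q ∈ (P ⊔ Ideal.span {h}).minimalPrimes) :
    ∃ c : Ideal (MvPolynomial (Fin d) ℂ) → ℕ,
      (∀ Q ∈ s, 1 ≤ c Q ∧ (∃ j < k, HasDim (zeroLocus ℂ Q) j) ∧
        HasDegree (zeroLocus ℂ Q) (c Q)) ∧
      ∑ Q ∈ s, c Q ≤ (n + E * n) * (n + E * n) := by
  have hp : ∀ Q ∈ s, Q.IsPrime := fun Q hQ => (hs Q hQ).1.1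
  have htr : ∀ Q ∈ s, Algebra.trdeg ℂ (MvPolynomial (Fin d) ℂ ⧸ Q) + 1 = (k : Cardinal) :=
    fun Q hQ => by rw [← hP]; exact trdeg_quotient_minimalPrimes_sup hh (hs Q hQ)
  rcases k with _ | k
  -- In dimension zero there is no component at all, since its transcendence degree plus one would
  -- be zero.
  · have hs0 : s = ∅ := Finset.eq_empty_of_forall_notMem fun Q hQ => by
      have := htr Q hQ
      simp at this
    subst hs0
    exact ⟨fun _ => 0, by simp, by simp⟩
  · have htr' : ∀ Q ∈ s, Algebra.trdeg ℂ (MvPolynomial (Fin d) ℂ ⧸ Q) = (k : Cardinal) := by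
      intro Q hQ
      have := htr Q hQ
      push_cast at this
      exact Cardinal.add_one_inj.mp this
    have hdata : ∀ Q ∈ s, ∃ c : ℕ, 1 ≤ c ∧ ∃ g : MvPolynomial ((Fin k × Fin d) ⊕ Fin k) ℂ,
        g ≠ 0 ∧ ∀ z, eval z g ≠ 0 → (zeroLocus ℂ Q ∩ slice id z).encard = c := by
      intro Q hQ
      have := hp Q hQ
      obtain ⟨c, hc1, hc, -, -⟩ := exists_slice_data Q (id : Fin k → Fin k)
        Function.injective_id (by simpa using htr' Q hQ)
      exact ⟨c, hc1, hc⟩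
    choose! c hc1 hc using hdata
    refine ⟨c, fun Q hQ => ?_, ?_⟩
    · have := hp Q hQ
      have hdim := hasDim_zeroLocus Q (htr' Q hQ)
      obtain ⟨g', hg', hgc⟩ := hc Q hQ
      exact ⟨hc1 Q hQ, ⟨k, Nat.lt_succ_self k, hdim⟩, hasDegree_of_generic hdim hg' hgc⟩
    · obtain ⟨g', hg', hgn'⟩ := generic_count_equiv (_root_.finSuccEquiv k) hg hgn
      exact sum_degree_le_of_hypersurface_section P (by simpa using hP) hg' hgn' hh hE s id hp
        (fun Q hQ => le_sup_left.trans (hs Q hQ).1.2)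
        (fun Q hQ => (hs Q hQ).1.2 (Ideal.mem_sup_right (Ideal.mem_span_singleton_self h)))
        Function.injective_id.injOn (by simpa using htr') c hc

theorem proposition4p3 (d D : ℕ) :
    ∃ C : ℕ, ∀ (k : ℕ) (V : Set (Fin d → ℂ)), IsVariety V → HasDim V k →
      (∃ δ : ℕ, δ ≤ D ∧ HasDegree V δ) →
      ∃ F : Finset (Set (Fin d → ℂ)), F.card ≤ C ∧
        (∀ W ∈ F, IsVariety W ∧ W ⊆ V ∧ (∃ j : ℕ, j < k ∧ HasDim W j) ∧
          ∃ δ : ℕ, δ ≤ C ∧ HasDegree W δ) ∧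
        singularLocus V k ⊆ ⋃ W ∈ F, W := by
  classical
  -- This bounds the degree of h uniformly in k: h comes from k+1 ≤ d+1 linear forms, each occurring
  -- with degree at most D.
  let E := (d + 1) * D
  refine ⟨(D + E * D) * (D + E * D), fun k V hV hdim hdeg => ?_⟩
  obtain ⟨δ, hδD, hδ⟩ := hdeg
  obtain ⟨P, hPp, rfl⟩ : ∃ P : Ideal (MvPolynomial (Fin d) ℂ), P.IsPrime ∧ V = zeroLocus ℂ P :=
    ⟨_, hV.isPrime_vanishingIdeal, hV.1.zeroLocus_vanishingIdeal.symm⟩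
  have hP := hdim.trdeg_eq
  have hkd := trdeg_quotient_le hP
  obtain ⟨n, -, ⟨g, hg, hgn⟩, -, -⟩ := exists_slice_data P (id : Fin k → Fin k)
    Function.injective_id (by simpa using hP)
  obtain rfl := hδ.eq_of_generic hdim hg hgn
  obtain ⟨F, -, hF, hFn, -, hFu⟩ := exists_chowForm P (by simpa using hP) hg hgn
  -- ∂F/∂y₀ is nonzero as a function on V times the space of matrices, so some numerical A leaves it
  -- nonzero at some point of V.
  obtain ⟨x₀, hx₀, A, hA⟩ := exists_pointEval_ne_zero P hFu
  rw [pointEval_sliceVec] at hA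
  let h := rowSubst A (pderiv (Sum.inr none) F)
  have hh : h ∉ P := fun hmem => hA (by rw [← hx₀ h hmem, aeval_rowSubst]; rfl)
  have hE : h.totalDegree ≤ E := by
    refine (totalDegree_rowSubst_le A fun i => (degreeOf_pderiv_le _ _ _).trans (hFn i)).trans ?_
    rw [Fintype.card_option, Fintype.card_fin]
    exact Nat.mul_le_mul (by omega) hδD
  have hfin : (P ⊔ Ideal.span {h}).minimalPrimes.Finite :=
    Ideal.finite_minimalPrimes_of_isNoetherianRing _ _
  let s := hfin.toFinset
  have hs : ∀ Q ∈ s, Q ∈ (P ⊔ Ideal.span {h}).minimalPrimes := fun Q hQ => hfin.mem_toFinset.mp hQ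
  obtain ⟨c, hc, hsum⟩ := exists_degrees_minimalPrimes P hP hg hgn hh hE hs
  have hsum' : ∑ Q ∈ s, c Q ≤ (D + E * D) * (D + E * D) := by
    refine hsum.trans (Nat.mul_le_mul ?_ ?_) <;>
      exact add_le_add hδD (Nat.mul_le_mul_left _ hδD)
  refine ⟨s.image (zeroLocus ℂ), ?_, ?_, ?_⟩
  -- Each component has degree at least one, so the sum of the degrees also bounds their number.
  · refine Finset.card_image_le.trans (le_trans ?_ hsum')
    rw [Finset.card_eq_sum_ones]
    exact Finset.sum_le_sum fun Q hQ => (hc Q hQ).1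
  · intro W hW
    obtain ⟨Q, hQ, rfl⟩ := Finset.mem_image.mp hW
    have := (hs Q hQ).1.1
    obtain ⟨-, hdimQ, hdegQ⟩ := hc Q hQ
    refine ⟨isVariety_zeroLocus Q, fun x hx p hp => hx p ((le_sup_left.trans (hs Q hQ).1.2) hp),
      hdimQ, c Q, ?_, hdegQ⟩
    exact (Finset.single_le_sum (fun _ _ => Nat.zero_le _) hQ).trans hsum'
  · rintro p ⟨hpV, hsing⟩
    have hph : aeval p h = 0 := by
      by_contra hne
      rw [aeval_rowSubst] at hne
      exact hsing (isSmoothPoint_of_chowForm hF hpV hne)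
    -- The maximal ideal of p contains P and h, hence a minimal prime over them, whose zero locus
    -- then contains p.
    have hle : P ⊔ Ideal.span {h} ≤ RingHom.ker (aeval (R := ℂ) p).toRingHom := by
      refine sup_le (fun q hq => hpV q hq) ?_
      rw [Ideal.span_singleton_le_iff_mem]
      exact hph
    have hprime : (RingHom.ker (aeval (R := ℂ) p).toRingHom).IsPrime := RingHom.ker_isPrime _
    obtain ⟨Q, hQ, hQle⟩ := Ideal.exists_minimalPrimes_le hle
    refine Set.mem_biUnion (Finset.mem_coe.mpr (Finset.mem_image_of_mem _
      (hfin.mem_toFinset.mpr hQ))) fun q hq => hQle hq
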